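/- Let $S$ be a scheme on which $2$ and $3$ are invertible, $G$ a flat $S$-group scheme (not necessarily abelian) and $X$ an $S$-scheme. For an open $W\subseteq X$ let $\Delta^n_W$ be the scheme of infinitesimal $n$-simplices of $W/S$: its $T$-points are the tuples $(x_0,\dots,x_n)$ of $T$-points of $W$ that are pairwise close to first order, i.e. each $(x_a,x_b)$ factors through the first-order neighbourhood of the diagonal. A $G$-valued $n$-form on $W$ is a morphism $\omega:\Delta^n_W\to G$ with $\omega(x_0,\dots,x_n)=1$ whenever $x_a=x_{a+1}$ for some $a$; $\mathrm{Aut}(G)$-valued forms are defined in the same way. Forms of degree $n\ge 1$ are written additively: $\omega+\omega'$ is the product $\omega\omega'$ of their values, and $-\omega$ is the inverse. A section $u$ of $\mathrm{Aut}(G)$ acts on forms by $u(\omega)(x_0,\dots,x_n)=u(x_0)(\omega(x_0,\dots,x_n))$. For an $\mathrm{Aut}(G)$-valued $1$-form $m$, the twisted de Rham differential of a $G$-valued $1$-form $\omega$ is the $2$-form $$d^1_m\omega(x,y,z)=\omega(x,y)\cdot m(x,y)\bigl(\omega(y,z)\bigr)\cdot\omega(x,z)^{-1}.$$ Let $\mathcal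 P$ be a gerbe (a stack in groupoids, locally non-empty and locally connected) over the category of $S$-schemes over $X$ with a Grothendieck topology. Let $p_0,p_1:\Delta^1_X\to X$ be the projections, and let $\varepsilon:p_1^*\mathcal P\to p_0^*\mathcal P$ be a connection, i.e. an equivalence together with an isomorphism from its restriction to the diagonal to the identity of $\mathcal P$. Let $(U_i)$ be an open cover of $X$, and write $U_{ij}=U_i\cap U_j$, $U_{ijk}=U_i\cap U_j\cap U_k$. Suppose given objects $x_i\in\mathcal P_{U_i}$, isomorphisms of sheaves of groups $G_{|U_i}\cong\mathrm{Aut}(x_i)$ (used below to identify sections of $G$ with automorphisms), arrows $\phi_{ij}:x_j\to x_i$ over $U_{ij}$, and arrows $\gamma_i:\varepsilon p_1^*x_i\to p_0^*x_i$ over $\Delta^1_{U_i}$ whose restriction to the diagonal is $1_{x_i}$ (under the given isomorphism). These define sections $\lambda_{ij}$ of $\mathrm{Aut}(G)$ over $U_{ij}$, $\mathrm{Aut}(G)$-valued $1$-forms $m_i$ on $U_i$, and $G$-valued $1$-forms $\gamma_{ij}$ on $U_{ij}$, by $$\lambda_{ij}(g)=\phi_{ij}\,g\,\phi_{ij}^{-1},\qquad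 m_i(g)=\gamma_i\,\varepsilon(g)\,\gamma_i^{-1},\qquad \gamma_{ij}\circ p_0^*\phi_{ij}\circ\gamma_j=\gamma_i\circ\varepsilon(p_1^*\phi_{ij}).$$ Put $\lambda_{ijk}=\lambda_{ij}\lambda_{jk}\lambda_{ik}^{-1}$ and, for a family $\omega=(\omega_{ij})$ of $G$-valued $n$-forms $\omega_{ij}$ on $U_{ij}$, define on $U_{ijk}$ $$\delta^1_\lambda(\omega)_{ijk}=\omega_{ij}+\lambda_{ij}(\omega_{jk})-\lambda_{ijk}(\omega_{ik}).$$ **Claim.** Let $\widetilde\gamma_{ij}=-\gamma_{ij}$. Then for all $i,j,k$ the following equality of $G$-valued $2$-forms on $U_{ijk}$ holds: $$d^1_{m_i}\bigl(\delta^1_\lambda(\widetilde\gamma)_{ijk}\bigr)=\delta^1_\lambda\bigl(d^1\widetilde\gamma\bigr)_{ijk},\qquad\text{where } (d^1\widetilde\gamma)_{ij}=d^1_{m_i}(\widetilde\gamma_{ij}).$$ -/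

import Mathlib

universe w v u

open CategoryTheory AlgebraicGeometry Opposite Limits
open scoped MonObj
open CategoryTheory.Pseudofunctor.LocallyDiscreteOpToCat

noncomputable section

namespace GerbeForms

variable {S : Scheme.{u}}

/-! ### Infinitesimal simplices and combinatorial differential forms -/

/-- The first-order infinitesimal neighbourhood of the diagonal of `X / S`: the closed subscheme,
with ideal `J ^ 2`, of the open subscheme of `X ×[S] X` in which the diagonal is closed, where `J`
is the ideal of the diagonal. -/
def diagNbhd (X : Over S) : Scheme.{u} :=
  ((pullback.diagonal X.hom).liftCoborder.ker ^ 2).subscheme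

/-- The immersion of the first-order neighbourhood of the diagonal into `X ×[S] X`. -/
def diagNbhdι (X : Over S) : diagNbhd X ⟶ pullback X.hom X.hom :=
  ((pullback.diagonal X.hom).liftCoborder.ker ^ 2).subschemeι ≫
    (pullback.diagonal X.hom).coborderRange.ι

/-- Two `T`-valued points of `X / S` are close to first order when the point `(x, y)` of
`X ×[S] X` factors through the first-order neighbourhood of the diagonal. -/
def Close {X T : Over S} (x y : T ⟶ X) : Prop :=
  ∃ h : T.left ⟶ diagNbhd X,
    h ≫ diagNbhdι X = pullback.lift x.left y.left ((Over.w x).trans (Over.w y).symm)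

lemma Close.comp {X T T' : Over S} {x y : T ⟶ X} (h : Close x y) (f : T' ⟶ T) :
    Close (f ≫ x) (f ≫ y) := by
  obtain ⟨k, hk⟩ := h
  refine ⟨f.left ≫ k, ?_⟩
  rw [Category.assoc, hk]
  apply pullback.hom_ext
  · rw [Category.assoc, pullback.lift_fst, pullback.lift_fst]; rfl
  · rw [Category.assoc, pullback.lift_snd, pullback.lift_snd]; rfl

/-- The diagonal factors through its first-order neighbourhood. -/
lemma exists_diag_factor (X : Over S) :
    ∃ k : X.left ⟶ diagNbhd X, k ≫ diagNbhdι X = pullback.diagonal X.hom := by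
  set d := pullback.diagonal X.hom
  have key : d.liftCoborder.ker ^ 2 ≤ d.liftCoborder.ker := fun U => by
    simpa using Ideal.pow_le_self (two_ne_zero)
  have e : (d.liftCoborder.toImage ≫ Scheme.IdealSheafData.inclusion key) ≫
      (d.liftCoborder.ker ^ 2).subschemeι ≫ d.coborderRange.ι = d := by
    have h1 := Scheme.IdealSheafData.inclusion_subschemeι key
    have h2 : d.liftCoborder.toImage ≫ d.liftCoborder.ker.subschemeι = d.liftCoborder :=
      Scheme.Hom.toImage_imageι _
    have h3 := d.liftCoborder_ι
    calc _ = (d.liftCoborder.toImage ≫ Scheme.IdealSheafData.inclusion key ≫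
          (d.liftCoborder.ker ^ 2).subschemeι) ≫ d.coborderRange.ι := by
            simp only [Category.assoc]
      _ = _ := by rw [h1, h2, h3]
  exact ⟨_, e⟩

lemma Close.refl {X T : Over S} (x : T ⟶ X) : Close x x := by
  obtain ⟨k, hk⟩ := exists_diag_factor X
  refine ⟨x.left ≫ k, ?_⟩
  rw [Category.assoc, hk]
  apply pullback.hom_ext
  · rw [Category.assoc, pullback.lift_fst, pullback.diagonal_fst, Category.comp_id]
  · rw [Category.assoc, pullback.lift_snd, pullback.diagonal_snd, Category.comp_id]

/-- A `T`-valued point of the scheme `Δⁿ` of infinitesimal `n`-simplices of `X / S`: an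
`(n + 1)`-tuple of `T`-valued points of `X` which are pairwise close to first order. -/
@[ext]
structure Simplex (X : Over S) (n : ℕ) (T : Over S) where
  /-- the vertices -/
  pt : Fin (n + 1) → (T ⟶ X)
  close : ∀ a b, Close (pt a) (pt b)

namespace Simplex

variable {X : Over S} {n : ℕ} {T T' : Over S}

/-- The `T'`-valued point of `Δⁿ` induced by a `T`-valued point and `f : T' ⟶ T`. -/
def pull (f : T' ⟶ T) (s : Simplex X n T) : Simplex X n T' where
  pt a := f ≫ s.pt a
  close a b := (s.close a b).comp f

/-- The `m`-simplex with vertices `s.pt (θ 0), …, s.pt (θ m)`. -/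
def face {m : ℕ} (s : Simplex X n T) (θ : Fin (m + 1) → Fin (n + 1)) : Simplex X m T where
  pt a := s.pt (θ a)
  close a b := s.close (θ a) (θ b)

/-- The constant simplex at `x`. -/
def const (n : ℕ) (x : T ⟶ X) : Simplex X n T where
  pt _ := x
  close _ _ := Close.refl x

lemma eq_const {s : Simplex X 1 T} {a : Fin 1} (h : s.pt a.castSucc = s.pt a.succ) :
    s = const 1 (s.pt 0) := by
  fin_cases a
  refine Simplex.ext (funext fun b => ?_)
  fin_cases b
  · rfl
  · exact h.symm

/-- The simplex lies in the open subscheme `W` of `X`. As `W` is open, these are the `T`-valued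
points of the scheme `Δⁿ` of `W / S`. -/
abbrev In (s : Simplex X n T) (W : X.left.Opens) : Prop :=
  ∀ a, Set.range (s.pt a).left ⊆ W

lemma In.pull {s : Simplex X n T} {W : X.left.Opens} (h : s.In W) (f : T' ⟶ T) :
    (s.pull f).In W := fun a => by
  rintro _ ⟨t, rfl⟩
  exact h a ⟨f.left t, by simp [Simplex.pull]⟩

lemma In.face {m : ℕ} {s : Simplex X n T} {W : X.left.Opens} (h : s.In W)
    (θ : Fin (m + 1) → Fin (n + 1)) : (s.face θ).In W := fun a => h (θ a)

lemma In.mono {s : Simplex X n T} {W W' : X.left.Opens} (h : s.In W) (hW : W ≤ W') : s.In W' :=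
  fun a => (h a).trans hW

end Simplex

variable (G : Over S) [GrpObj G] {X : Over S}

/-- A `G`-valued combinatorial differential `n`-form on the open subscheme `W` of `X / S`: a
morphism `Δⁿ ⟶ G`, given on `T`-valued points, that is trivial on the degenerate simplices.
For `n = 0` this is a section of `G` over `W`. -/
@[ext]
structure GForm (n : ℕ) (W : X.left.Opens) where
  /-- the value on a `T`-valued point of `Δⁿ` -/
  val : ∀ {T : Over S} (s : Simplex X n T), s.In W → (T ⟶ G)
  val_pull : ∀ {T T' : Over S} (f : T' ⟶ T) (s : Simplex X n T) (h : s.In W),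
    val (s.pull f) (h.pull f) = f ≫ val s h
  val_degenerate : ∀ {T : Over S} (s : Simplex X n T) (h : s.In W) (a : Fin n),
    s.pt a.castSucc = s.pt a.succ → val s h = 1

/-- An `Aut(G)`-valued combinatorial differential `n`-form on `W`: it sends a `T`-valued point `s`
of `Δⁿ` to the automorphism of the `T`-group `G ×[S] T` which acts on the points with values in
`f : T' ⟶ T` by `val (s.pull f)`, and it is trivial on the degenerate simplices.
For `n = 0` this is a section over `W` of the sheaf `Aut(G)`. -/
@[ext]
structure AutForm (n : ℕ) (W : X.left.Opens) where
  /-- the action of the value at a `T`-valued point of `Δⁿ` on the `T`-valued points of `G` -/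
  val : ∀ {T : Over S} (s : Simplex X n T), s.In W → ((T ⟶ G) ≃* (T ⟶ G))
  val_pull : ∀ {T T' : Over S} (f : T' ⟶ T) (s : Simplex X n T) (h : s.In W) (g : T ⟶ G),
    val (s.pull f) (h.pull f) (f ≫ g) = f ≫ val s h g
  val_degenerate : ∀ {T : Over S} (s : Simplex X n T) (h : s.In W) (a : Fin n),
    s.pt a.castSucc = s.pt a.succ → val s h = MulEquiv.refl _

variable {G} {n : ℕ} {W W' : X.left.Opens}

namespace GForm

instance : Mul (GForm G n W) where
  mul ω ω' :=
    { val := fun s h => ω.val s h * ω'.val s h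
      val_pull := fun f s h => by rw [ω.val_pull, ω'.val_pull, MonObj.comp_mul]
      val_degenerate := fun s h a ha => by
        rw [ω.val_degenerate s h a ha, ω'.val_degenerate s h a ha, one_mul] }

instance : Inv (GForm G n W) where
  inv ω :=
    { val := fun s h => (ω.val s h)⁻¹
      val_pull := fun f s h => by rw [ω.val_pull, GrpObj.comp_inv]
      val_degenerate := fun s h a ha => by rw [ω.val_degenerate s h a ha, inv_one] }

instance : One (GForm G n W) where
  one :=
    { val := fun _ _ => 1
      val_pull := fun f _ _ => (MonObj.comp_one f).symm
      val_degenerate := fun _ _ _ _ => rfl }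

/-- The group of `G`-valued `n`-forms (`n ≥ 1` being the case written additively). -/
instance : Group (GForm G n W) where
  mul_assoc ω₁ ω₂ ω₃ := GForm.ext (by
    funext T s h; exact mul_assoc (ω₁.val s h) (ω₂.val s h) (ω₃.val s h))
  one_mul ω := GForm.ext (by funext T s h; exact one_mul (ω.val s h))
  mul_one ω := GForm.ext (by funext T s h; exact mul_one (ω.val s h))
  inv_mul_cancel ω := GForm.ext (by funext T s h; exact inv_mul_cancel (ω.val s h))

/-- Restriction of forms to a smaller open subscheme. -/
def restrict (ω : GForm G n W) (hW : W' ≤ W) : GForm G n W' where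
  val s h := ω.val s (h.mono hW)
  val_pull f s h := ω.val_pull f s (h.mono hW)
  val_degenerate s h := ω.val_degenerate s (h.mono hW)

end GForm

namespace AutForm

/-- Restriction of `Aut(G)`-valued forms to a smaller open subscheme. -/
def restrict (u : AutForm G n W) (hW : W' ≤ W) : AutForm G n W' where
  val s h := u.val s (h.mono hW)
  val_pull f s h := u.val_pull f s (h.mono hW)
  val_degenerate s h := u.val_degenerate s (h.mono hW)

/-- The composite of two sections of `Aut(G)`. -/
instance : Mul (AutForm G 0 W) where
  mul u v :=
    { val := fun s h => (v.val s h).trans (u.val s h)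
      val_pull := fun f s h g => by
        simp only [MulEquiv.trans_apply]
        rw [v.val_pull f s h, u.val_pull f s h]
      val_degenerate := fun _ _ a => a.elim0 }

/-- The inverse of a section of `Aut(G)`. -/
instance : Inv (AutForm G 0 W) where
  inv u :=
    { val := fun s h => (u.val s h).symm
      val_pull := fun f s h g => by
        rw [MulEquiv.symm_apply_eq, u.val_pull f s h, MulEquiv.apply_symm_apply]
      val_degenerate := fun _ _ a => a.elim0 }

/-- The action `u(ω)` of a section `u` of `Aut(G)` on a `G`-valued form `ω`, by
`u(ω)(x₀, …, xₙ) = u(x₀)(ω(x₀, …, xₙ))`. -/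
def act (u : AutForm G 0 W) (ω : GForm G n W) : GForm G n W where
  val s h := u.val (s.face ![0]) (h.face _) (ω.val s h)
  val_pull f s h := by rw [ω.val_pull f s h]; exact u.val_pull f (s.face ![0]) (h.face _) _
  val_degenerate s h a ha := by rw [ω.val_degenerate s h a ha, map_one]

/-- The twisted de Rham differential `d¹ₘ` attached to an `Aut(G)`-valued 1-form `m`:
`(d¹ₘ ω)(x, y, z) = ω(x, y) · m(x, y)(ω(y, z)) · ω(x, z)⁻¹`. -/
def d1 (m : AutForm G 1 W) (ω : GForm G 1 W) : GForm G 2 W where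
  val s h := ω.val (s.face ![0, 1]) (h.face _) *
    m.val (s.face ![0, 1]) (h.face _) (ω.val (s.face ![1, 2]) (h.face _)) *
    (ω.val (s.face ![0, 2]) (h.face _))⁻¹
  val_pull f s h := by
    rw [MonObj.comp_mul, MonObj.comp_mul, GrpObj.comp_inv, ← ω.val_pull, ← ω.val_pull, ← m.val_pull,
      ← ω.val_pull]
    rfl
  val_degenerate {T} s h a ha := by
    fin_cases a
    · replace ha : s.pt 0 = s.pt 1 := ha
      have e : s.face ![0, 2] = s.face ![1, 2] := by
        ext i; fin_cases i
        · simp [Simplex.face, ha]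
        · rfl
      have h1 := ω.val_degenerate (s.face ![0, 1]) (h.face _) 0 (by simpa [Simplex.face] using ha)
      have h2 := m.val_degenerate (s.face ![0, 1]) (h.face _) 0 (by simpa [Simplex.face] using ha)
      have h3 : ω.val (s.face ![0, 2]) (h.face _) = ω.val (s.face ![1, 2]) (h.face _) := by
        congr 1
      rw [h1, h2, h3]; simp
    · replace ha : s.pt 1 = s.pt 2 := ha
      have e : s.face ![0, 2] = s.face ![0, 1] := by
        ext i; fin_cases i
        · rfl
        · simp [Simplex.face, ha]
      have h1 := ω.val_degenerate (s.face ![1, 2]) (h.face _) 0 (by simpa [Simplex.face] using ha)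
      have h3 : ω.val (s.face ![0, 2]) (h.face _) = ω.val (s.face ![0, 1]) (h.face _) := by
        congr 1
      rw [h1, h3]; simp

end AutForm

/-! ### Gerbes and connections -/

/-- The category of infinitesimal 1-simplices of `X / S`, i.e. of `S`-schemes over `Δ¹`. -/
structure InfPair (X : Over S) where
  /-- the `S`-scheme -/
  base : Over S
  /-- the point of `Δ¹` with values in it -/
  simplex : Simplex X 1 base

namespace InfPair

variable {X : Over S}

instance : Category (InfPair X) where
  Hom e' e := { f : e'.base ⟶ e.base // e.simplex.pull f = e'.simplex }
  id e := ⟨𝟙 _, by ext a; simp [Simplex.pull]⟩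
  comp {e₁ e₂ e₃} f g := ⟨f.1 ≫ g.1, by
    have h := f.2.symm.trans (congrArg (Simplex.pull f.1) g.2.symm)
    exact (Simplex.ext (funext fun a => Category.assoc _ _ _)).trans h.symm⟩

lemma hom_pt {e' e : InfPair X} (f : e' ⟶ e) (a : Fin 2) :
    f.1 ≫ e.simplex.pt a = e'.simplex.pt a :=
  congrFun (congrArg Simplex.pt f.2) a

/-- The projection `pₐ : Δ¹ ⟶ X` to the `a`-th vertex, as a functor sending an `S`-scheme over
`Δ¹` to the underlying `S`-scheme over `X`. -/
def vertex (a : Fin 2) : InfPair X ⥤ Over X where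
  obj e := Over.mk (e.simplex.pt a)
  map f := Over.homMk f.1 (hom_pt f a)

/-- The diagonal `X ⟶ Δ¹`, as a functor on `S`-schemes over `X`. -/
def diag : Over X ⥤ InfPair X where
  obj V := ⟨V.left, Simplex.const 1 V.hom⟩
  map f := ⟨f.left, by
    have h : f.left ≫ _ = _ := Over.w f
    exact Simplex.ext (funext fun _ => h)⟩

end InfPair

set_option linter.checkUnivs false in
/-- Fibred categories over the `S`-schemes over `X`. -/
abbrev Fibred (X : Over S) := Pseudofunctor (LocallyDiscrete (Over X)ᵒᵖ) Cat.{w, v}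

namespace Fibred

variable {X : Over S} (P : Fibred.{w, v, u} X)

/-- The fibre category over `V`. -/
abbrev Fib (V : Over X) : Cat.{w, v} := P.obj (.mk (op V))

/-- The pullback functor along `t`. -/
abbrev res {V T : Over X} (t : T ⟶ V) : P.Fib V ⥤ P.Fib T := (P.map t.op.toLoc).toFunctor

/-- The pullback of `P` to `Δ¹` along the projection to the `a`-th vertex. -/
def pullVertex (a : Fin 2) : Pseudofunctor (LocallyDiscrete (InfPair X)ᵒᵖ) Cat.{w, v} :=
  (InfPair.vertex a).op.toPseudofunctor.comp P

end Fibred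

/-- A gerbe for the topology `J`: a stack in groupoids which is locally nonempty and locally
connected. -/
structure IsGerbe {X : Over S} (J : GrothendieckTopology (Over X)) (P : Fibred.{w, v, u} X) :
    Prop where
  isStack : P.IsStack J
  groupoid : ∀ V : Over X, IsGroupoid (P.Fib V)
  locally_nonempty : ∀ V : Over X, ∃ R ∈ J V, ∀ ⦃T : Over X⦄ (t : T ⟶ V), R t →
    Nonempty (P.Fib T)
  locally_connected : ∀ (V : Over X) (M N : P.Fib V), ∃ R ∈ J V, ∀ ⦃T : Over X⦄ (t : T ⟶ V),
    R t → Nonempty ((P.res t).obj M ⟶ (P.res t).obj N)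

/-- Morphisms `p₁^* P ⟶ p₀^* P` over `Δ¹`. -/
abbrev Transport {X : Over S} (P : Fibred.{w, v, u} X) :=
  Pseudofunctor.StrongTrans (P.pullVertex 1) (P.pullVertex 0)

namespace Transport

variable {X : Over S} {P : Fibred.{w, v, u} X} (ε : Transport P)

/-- The functor `ε` between the fibre categories at a point `(x, y)` of `Δ¹`. -/
def fiber (e : InfPair X) :
    P.Fib ((InfPair.vertex 1).obj e) ⥤ P.Fib ((InfPair.vertex 0).obj e) :=
  (ε.app (.mk (op e))).toFunctor

/-- The compatibility of `ε` with pullbacks. -/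
def natIso {e' e : InfPair X} (f : e' ⟶ e) :
    P.res ((InfPair.vertex 1).map f) ⋙ ε.fiber e' ≅ ε.fiber e ⋙ P.res ((InfPair.vertex 0).map f) :=
  Cat.Hom.toNatIso (ε.naturality f.op.toLoc)

/-- The pullback along `f : e' ⟶ e` of an arrow `ε (t₁^* M₁) ⟶ t₀^* M₀` at the point `e` of `Δ¹`. -/
def pullArrow {e' e : InfPair X} (f : e' ⟶ e) {V₁ V₀ : Over X} {M₁ : P.Fib V₁} {M₀ : P.Fib V₀}
    {t₁ : (InfPair.vertex 1).obj e ⟶ V₁} {t₀ : (InfPair.vertex 0).obj e ⟶ V₀}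
    (φ : (ε.fiber e).obj ((P.res t₁).obj M₁) ⟶ (P.res t₀).obj M₀)
    (t₁' : (InfPair.vertex 1).obj e' ⟶ V₁) (t₀' : (InfPair.vertex 0).obj e' ⟶ V₀)
    (h₁ : (InfPair.vertex 1).map f ≫ t₁ = t₁') (h₀ : (InfPair.vertex 0).map f ≫ t₀ = t₀') :
    (ε.fiber e').obj ((P.res t₁').obj M₁) ⟶ (P.res t₀').obj M₀ :=
  (ε.fiber e').map ((P.mapComp' t₁.op.toLoc ((InfPair.vertex 1).map f).op.toLoc t₁'.op.toLoc
      (by subst h₁; rfl)).hom.toNatTrans.app M₁) ≫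
    (ε.natIso f).hom.app ((P.res t₁).obj M₁) ≫
    (P.res ((InfPair.vertex 0).map f)).map φ ≫
    (P.mapComp' t₀.op.toLoc ((InfPair.vertex 0).map f).op.toLoc t₀'.op.toLoc
      (by subst h₀; rfl)).inv.toNatTrans.app M₀

end Transport

/-- A connection on `P`: an equivalence `ε : p₁^* P ⟶ p₀^* P` over `Δ¹`, together with a natural
isomorphism between its restriction to the diagonal and the identity of `P`. -/
structure Connection {X : Over S} (P : Fibred.{w, v, u} X) where
  /-- the morphism `p₁^* P ⟶ p₀^* P` -/
  ε : Transport P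
  isEquivalence : ∀ e : InfPair X, (ε.fiber e).IsEquivalence
  /-- the restriction to the diagonal is isomorphic to the identity, on each fibre category -/
  unit (V : Over X) : (show P.Fib V ⥤ P.Fib V from ε.fiber (InfPair.diag.obj V)) ≅ 𝟭 (P.Fib V)
  unit_naturality {V T : Over X} (t : T ⟶ V) (M : P.Fib V) :
    (unit T).hom.app ((P.res t).obj M) =
      (ε.natIso (InfPair.diag.map t)).hom.app M ≫ (P.res t).map ((unit V).hom.app M)

namespace Fibred

variable {X : Over S} {P : Fibred.{w, v, u} X}

lemma pullHom_comp {V₁ V₂ V₃ : Over X} {M₁ : P.Fib V₁} {M₂ : P.Fib V₂} {M₃ : P.Fib V₃}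
    {T T' : Over X} {t₁ : T ⟶ V₁} {t₂ : T ⟶ V₂} {t₃ : T ⟶ V₃}
    (φ : (P.res t₁).obj M₁ ⟶ (P.res t₂).obj M₂) (ψ : (P.res t₂).obj M₂ ⟶ (P.res t₃).obj M₃)
    (f : T' ⟶ T) (t₁' : T' ⟶ V₁) (t₂' : T' ⟶ V₂) (t₃' : T' ⟶ V₃)
    (h₁ : f ≫ t₁ = t₁') (h₂ : f ≫ t₂ = t₂') (h₃ : f ≫ t₃ = t₃') :
    pullHom φ f t₁' t₂' h₁ h₂ ≫ pullHom ψ f t₂' t₃' h₂ h₃ = pullHom (φ ≫ ψ) f t₁' t₃' h₁ h₃ := by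
  simp only [pullHom, Category.assoc, Functor.map_comp]
  congr 2
  exact (Category.assoc _ _ _).symm.trans
    ((congrArg (· ≫ _) (Cat.Hom.inv_hom_id_toNatTrans_app _ _)).trans (Category.id_comp _))

lemma pullHom_id' {V : Over X} {M : P.Fib V} {T T' : Over X} {t : T ⟶ V}
    (f : T' ⟶ T) (t' : T' ⟶ V) (h : f ≫ t = t') :
    pullHom (𝟙 ((P.res t).obj M)) f t' t' h h = 𝟙 ((P.res t').obj M) := by
  simp only [pullHom]
  rw [CategoryTheory.Functor.map_id]
  exact (congrArg (_ ≫ ·) (Category.id_comp _)).trans (Cat.Hom.hom_inv_id_toNatTrans_app _ _)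

/-- The pullback of an isomorphism of pullbacks. -/
def pullIso {V₁ V₂ : Over X} {M₁ : P.Fib V₁} {M₂ : P.Fib V₂} {T T' : Over X} {t₁ : T ⟶ V₁}
    {t₂ : T ⟶ V₂} (φ : (P.res t₁).obj M₁ ≅ (P.res t₂).obj M₂) (f : T' ⟶ T)
    (t₁' : T' ⟶ V₁) (t₂' : T' ⟶ V₂) (h₁ : f ≫ t₁ = t₁') (h₂ : f ≫ t₂ = t₂') :
    (P.res t₁').obj M₁ ≅ (P.res t₂').obj M₂ where
  hom := pullHom φ.hom f t₁' t₂' h₁ h₂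
  inv := pullHom φ.inv f t₂' t₁' h₂ h₁
  hom_inv_id := by rw [pullHom_comp _ _ _ _ _ _ h₁ h₂ h₁, φ.hom_inv_id, pullHom_id']
  inv_hom_id := by rw [pullHom_comp _ _ _ _ _ _ h₂ h₁ h₂, φ.inv_hom_id, pullHom_id']

lemma pullIso_trans {V₁ V₂ V₃ : Over X} {M₁ : P.Fib V₁} {M₂ : P.Fib V₂} {M₃ : P.Fib V₃}
    {T T' : Over X} {t₁ : T ⟶ V₁} {t₂ : T ⟶ V₂} {t₃ : T ⟶ V₃}
    (φ : (P.res t₁).obj M₁ ≅ (P.res t₂).obj M₂) (ψ : (P.res t₂).obj M₂ ≅ (P.res t₃).obj M₃)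
    (f : T' ⟶ T) (t₁' : T' ⟶ V₁) (t₂' : T' ⟶ V₂) (t₃' : T' ⟶ V₃)
    (h₁ : f ≫ t₁ = t₁') (h₂ : f ≫ t₂ = t₂') (h₃ : f ≫ t₃ = t₃') :
    pullIso (φ ≪≫ ψ) f t₁' t₃' h₁ h₃ = pullIso φ f t₁' t₂' h₁ h₂ ≪≫ pullIso ψ f t₂' t₃' h₂ h₃ :=
  Iso.ext (pullHom_comp φ.hom ψ.hom f t₁' t₂' t₃' h₁ h₂ h₃).symm

lemma pullIso_symm {V₁ V₂ : Over X} {M₁ : P.Fib V₁} {M₂ : P.Fib V₂}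
    {T T' : Over X} {t₁ : T ⟶ V₁} {t₂ : T ⟶ V₂} (φ : (P.res t₁).obj M₁ ≅ (P.res t₂).obj M₂)
    (f : T' ⟶ T) (t₁' : T' ⟶ V₁) (t₂' : T' ⟶ V₂) (h₁ : f ≫ t₁ = t₁') (h₂ : f ≫ t₂ = t₂') :
    pullIso φ.symm f t₂' t₁' h₂ h₁ = (pullIso φ f t₁' t₂' h₁ h₂).symm :=
  rfl

end Fibred

section Opens

variable {X : Over S}

/-- An open subscheme of `X`, as an `S`-scheme over `X`. -/
def openOver (W : X.left.Opens) : Over X :=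
  Over.mk (Over.homMk W.ι : Over.mk (W.ι ≫ X.hom) ⟶ X)

lemma openOver_hom_ext {W : X.left.Opens} {V : Over X} (t t' : V ⟶ openOver W) : t = t' := by
  have h1 : (show V.left.left ⟶ W.toScheme from t.left.left) ≫ W.ι = V.hom.left :=
    congrArg (·.left) (Over.w t)
  have h2 : (show V.left.left ⟶ W.toScheme from t'.left.left) ≫ W.ι = V.hom.left :=
    congrArg (·.left) (Over.w t')
  have h : t.left.left = t'.left.left := (cancel_mono W.ι).1 (h1.trans h2.symm)
  exact Over.OverMorphism.ext (Over.OverMorphism.ext h)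

/-- The factorization through `W` of an `S`-scheme over `X` which lands in `W`. -/
def liftOpen (V : Over X) (W : X.left.Opens) (h : Set.range V.hom.left ⊆ W) : V ⟶ openOver W :=
  let x : V.left.left ⟶ X.left := V.hom.left
  have h' : Set.range x ⊆ Set.range W.ι := h.trans W.range_ι.symm.subset
  let l : V.left.left ⟶ W.toScheme := IsOpenImmersion.lift W.ι x h'
  have h1 : l ≫ W.ι = x := IsOpenImmersion.lift_fac _ _ _
  Over.homMk
    (Over.homMk l
      (((Category.assoc _ _ _).symm.trans (congrArg (· ≫ X.hom) h1)).trans (Over.w V.hom)))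
    (Over.OverMorphism.ext h1)

/-- The inclusion of a smaller open subscheme. -/
def openLE {W W' : X.left.Opens} (h : W ≤ W') : openOver W ⟶ openOver W' :=
  liftOpen _ _ (by
    have : Set.range (openOver W).hom.left = (W : Set X.left) := W.range_ι
    rw [this]; exact h)

end Opens

namespace Transport

variable {X : Over S} {P : Fibred.{w, v, u} X} (ε : Transport P)

lemma pullArrow_map_comp {e' e : InfPair X} (f : e' ⟶ e) {V₁ V₁' V₀ : Over X} {M₁ : P.Fib V₁}
    {M₁' : P.Fib V₁'} {M₀ : P.Fib V₀} {t₁ : (InfPair.vertex 1).obj e ⟶ V₁}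
    {s₁ : (InfPair.vertex 1).obj e ⟶ V₁'} {t₀ : (InfPair.vertex 0).obj e ⟶ V₀}
    (α : (P.res s₁).obj M₁' ⟶ (P.res t₁).obj M₁)
    (φ : (ε.fiber e).obj ((P.res t₁).obj M₁) ⟶ (P.res t₀).obj M₀)
    (t₁' : (InfPair.vertex 1).obj e' ⟶ V₁) (s₁' : (InfPair.vertex 1).obj e' ⟶ V₁')
    (t₀' : (InfPair.vertex 0).obj e' ⟶ V₀)
    (h₁ : (InfPair.vertex 1).map f ≫ t₁ = t₁') (h₁' : (InfPair.vertex 1).map f ≫ s₁ = s₁')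
    (h₀ : (InfPair.vertex 0).map f ≫ t₀ = t₀') :
    ε.pullArrow f ((ε.fiber e).map α ≫ φ) s₁' t₀' h₁' h₀ =
      (ε.fiber e').map (pullHom α ((InfPair.vertex 1).map f) s₁' t₁' h₁' h₁) ≫
        ε.pullArrow f φ t₁' t₀' h₁ h₀ := by
  have nat := (ε.natIso f).hom.naturality α
  simp only [Functor.comp_map] at nat
  have hinv := Cat.Hom.inv_hom_id_toNatTrans_app (P.mapComp' t₁.op.toLoc
    ((InfPair.vertex 1).map f).op.toLoc t₁'.op.toLoc (by subst h₁; rfl)) M₁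
  have hinv' := congrArg (ε.fiber e').map hinv
  rw [Functor.map_comp] at hinv'
  simp only [pullArrow, pullHom, Functor.map_comp, Category.assoc]
  rw [reassoc_of% hinv']
  refine congrArg (_ ≫ ·) ?_
  erw [CategoryTheory.Functor.map_id, Category.id_comp]
  exact (Category.assoc _ _ _).symm.trans
    ((congrArg (· ≫ _) nat.symm).trans (Category.assoc _ _ _))

lemma pullArrow_comp {e' e : InfPair X} (f : e' ⟶ e) {V₁ V₀ V₀' : Over X} {M₁ : P.Fib V₁}
    {M₀ : P.Fib V₀} {M₀' : P.Fib V₀'} {t₁ : (InfPair.vertex 1).obj e ⟶ V₁}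
    {t₀ : (InfPair.vertex 0).obj e ⟶ V₀} {s₀ : (InfPair.vertex 0).obj e ⟶ V₀'}
    (φ : (ε.fiber e).obj ((P.res t₁).obj M₁) ⟶ (P.res t₀).obj M₀)
    (β : (P.res t₀).obj M₀ ⟶ (P.res s₀).obj M₀')
    (t₁' : (InfPair.vertex 1).obj e' ⟶ V₁) (t₀' : (InfPair.vertex 0).obj e' ⟶ V₀)
    (s₀' : (InfPair.vertex 0).obj e' ⟶ V₀')
    (h₁ : (InfPair.vertex 1).map f ≫ t₁ = t₁') (h₀ : (InfPair.vertex 0).map f ≫ t₀ = t₀')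
    (h₀' : (InfPair.vertex 0).map f ≫ s₀ = s₀') :
    ε.pullArrow f (φ ≫ β) t₁' s₀' h₁ h₀' =
      ε.pullArrow f φ t₁' t₀' h₁ h₀ ≫ pullHom β ((InfPair.vertex 0).map f) t₀' s₀' h₀ h₀' := by
  have hinv := Cat.Hom.inv_hom_id_toNatTrans_app (P.mapComp' t₀.op.toLoc
    ((InfPair.vertex 0).map f).op.toLoc t₀'.op.toLoc (by subst h₀; rfl)) M₀
  simp only [pullArrow, pullHom, Functor.map_comp, Category.assoc]
  rw [reassoc_of% hinv]

end Transport

/-- Local data for a gerbe with connection on an open cover: objects `xᵢ` over `Uᵢ`,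
identifications of `G` with the sheaves of automorphisms of the `xᵢ`, arrows `φᵢⱼ : xⱼ ⟶ xᵢ`
over `Uᵢⱼ`, and arrows `γᵢ : ε (p₁^* xᵢ) ⟶ p₀^* xᵢ` over the infinitesimal 1-simplices of `Uᵢ`,
which are the identity on the diagonal. All fibre categories being groupoids, arrows are given
as isomorphisms. -/
structure LocalData (G : Over S) [GrpObj G] {X : Over S} {P : Fibred.{w, v, u} X}
    (C : Connection P) {I : Type*} (U : I → X.left.Opens) where
  /-- the local objects -/
  obj (i : I) : P.Fib (openOver (U i))
  /-- the identification of the automorphisms of a pullback of `xᵢ` with the sections of `G` -/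
  band (i : I) {T : Over X} (t : T ⟶ openOver (U i)) :
    (T.left ⟶ G) ≃* Aut ((P.res t).obj (obj i))
  band_pull (i : I) {T T' : Over X} (f : T' ⟶ T) (t : T ⟶ openOver (U i))
    (t' : T' ⟶ openOver (U i)) (h : f ≫ t = t') (g : T.left ⟶ G) :
    (band i t' (f.left ≫ g)).hom = pullHom (band i t g).hom f t' t' h h
  /-- the arrows `φᵢⱼ : xⱼ ⟶ xᵢ` -/
  phi (i j : I) : (P.res (openLE (inf_le_right : U i ⊓ U j ≤ U j))).obj (obj j) ≅
    (P.res (openLE (inf_le_left : U i ⊓ U j ≤ U i))).obj (obj i)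
  /-- the arrows `γᵢ : ε (p₁^* xᵢ) ⟶ p₀^* xᵢ` -/
  gam (i : I) (e : InfPair X) (h : e.simplex.In (U i)) :
    (C.ε.fiber e).obj ((P.res (liftOpen ((InfPair.vertex 1).obj e) (U i) (h 1))).obj (obj i)) ≅
      (P.res (liftOpen ((InfPair.vertex 0).obj e) (U i) (h 0))).obj (obj i)
  gam_pull (i : I) {e e' : InfPair X} (f : e' ⟶ e) (h : e.simplex.In (U i))
    (h' : e'.simplex.In (U i)) :
    (gam i e' h').hom = C.ε.pullArrow f (gam i e h).hom _ _
      (openOver_hom_ext _ _) (openOver_hom_ext _ _)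
  gam_diag (i : I) (V : Over X) (h : (InfPair.diag.obj V).simplex.In (U i)) :
    (gam i (InfPair.diag.obj V) h).hom =
      (C.unit V).hom.app ((P.res (liftOpen V (U i) (h 0))).obj (obj i))

namespace LocalData

variable {G : Over S} [GrpObj G] {X : Over S} {P : Fibred.{w, v, u} X}
  {C : Connection P} {I : Type*} {U : I → X.left.Opens} (D : LocalData G C U)

/-- The pullback of `xᵢ` to `V`. -/
abbrev objOn (i : I) (V : Over X) (h : Set.range V.hom.left ⊆ U i) : P.Fib V :=
  (P.res (liftOpen V (U i) h)).obj (D.obj i)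

/-- The identification of the automorphisms of the pullback of `xᵢ` to `V`. -/
abbrev bandOn (i : I) (V : Over X) (h : Set.range V.hom.left ⊆ U i) :
    (V.left ⟶ G) ≃* Aut (D.objOn i V h) :=
  D.band i (liftOpen V (U i) h)

/-- The pullback of `φᵢⱼ` to `V`. -/
def phiOn (i j : I) (V : Over X) (h : Set.range V.hom.left ⊆ (U i ⊓ U j : X.left.Opens)) :
    D.objOn j V (h.trans inf_le_right) ≅ D.objOn i V (h.trans inf_le_left) :=
  Fibred.pullIso (D.phi i j) (liftOpen V _ h) _ _ (openOver_hom_ext _ _) (openOver_hom_ext _ _)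

lemma phiOn_pull (i j : I) {V V' : Over X} (f : V' ⟶ V)
    (h : Set.range V.hom.left ⊆ (U i ⊓ U j : X.left.Opens))
    (h' : Set.range V'.hom.left ⊆ (U i ⊓ U j : X.left.Opens)) :
    D.phiOn i j V' h' = Fibred.pullIso (D.phiOn i j V h) f _ _
      (openOver_hom_ext _ _) (openOver_hom_ext _ _) := by
  ext
  refine Eq.trans ?_ (pullHom_pullHom (D.phi i j).hom (liftOpen V _ h)
    (liftOpen V _ (h.trans inf_le_right)) (liftOpen V _ (h.trans inf_le_left)) f
    (liftOpen V' _ (h'.trans inf_le_right)) (liftOpen V' _ (h'.trans inf_le_left))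
    (openOver_hom_ext _ _) (openOver_hom_ext _ _) (openOver_hom_ext _ _)
    (openOver_hom_ext _ _)).symm
  have e : liftOpen V' _ h' = f ≫ liftOpen V _ h := openOver_hom_ext _ _
  have key : ∀ (a b : V' ⟶ openOver (U i ⊓ U j)) (hab : a = b)
      (t₁ : V' ⟶ openOver (U j)) (t₂ : V' ⟶ openOver (U i))
      (h₁ : a ≫ openLE inf_le_right = t₁) (h₂ : a ≫ openLE inf_le_left = t₂)
      (h₁' : b ≫ openLE inf_le_right = t₁) (h₂' : b ≫ openLE inf_le_left = t₂),
      pullHom (D.phi i j).hom a t₁ t₂ h₁ h₂ = pullHom (D.phi i j).hom b t₁ t₂ h₁' h₂' := by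
    rintro a b rfl _ _ _ _ _ _; rfl
  exact key _ _ e _ _ (openOver_hom_ext _ _) (openOver_hom_ext _ _) _ _

lemma bandOn_pull (i : I) {V V' : Over X} (f : V' ⟶ V) (h : Set.range V.hom.left ⊆ U i)
    (h' : Set.range V'.hom.left ⊆ U i) (g : V.left ⟶ G) :
    D.bandOn i V' h' (f.left ≫ g) = Fibred.pullIso (D.bandOn i V h g) f _ _
      (openOver_hom_ext _ _) (openOver_hom_ext _ _) :=
  Iso.ext (D.band_pull i f _ _ (openOver_hom_ext _ _) g)

end LocalData

namespace LocalData

variable {G : Over S} [GrpObj G] {X : Over S} {P : Fibred.{w, v, u} X}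
  {C : Connection P} {I : Type*} {U : I → X.left.Opens} (D : LocalData G C U)

/-- Conjugation by `φᵢⱼ` on the sections of `G` over `V`. -/
def lamOn (i j : I) (V : Over X) (h : Set.range V.hom.left ⊆ (U i ⊓ U j : X.left.Opens)) :
    (V.left ⟶ G) ≃* (V.left ⟶ G) :=
  ((D.bandOn j V (h.trans inf_le_right)).trans (D.phiOn i j V h).conjAut).trans
    (D.bandOn i V (h.trans inf_le_left)).symm

lemma bandOn_lamOn (i j : I) (V : Over X)
    (h : Set.range V.hom.left ⊆ (U i ⊓ U j : X.left.Opens)) (g : V.left ⟶ G) :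
    D.bandOn i V (h.trans inf_le_left) (D.lamOn i j V h g) =
      (D.phiOn i j V h).symm ≪≫ D.bandOn j V (h.trans inf_le_right) g ≪≫ D.phiOn i j V h := by
  exact (MulEquiv.apply_symm_apply (D.bandOn i V (h.trans inf_le_left)) _).trans
    (Iso.conjAut_apply _ _)

lemma lamOn_pull (i j : I) {V V' : Over X} (f : V' ⟶ V)
    (h : Set.range V.hom.left ⊆ (U i ⊓ U j : X.left.Opens))
    (h' : Set.range V'.hom.left ⊆ (U i ⊓ U j : X.left.Opens)) (g : V.left ⟶ G) :
    D.lamOn i j V' h' (f.left ≫ g) = f.left ≫ D.lamOn i j V h g := by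
  apply (D.bandOn i V' (h'.trans inf_le_left)).injective
  rw [bandOn_lamOn, D.bandOn_pull i f (h.trans inf_le_left), bandOn_lamOn,
    D.bandOn_pull j f (h.trans inf_le_right), D.phiOn_pull i j f h h']
  exact ((Fibred.pullIso_trans (D.phiOn i j V h).symm _ f _ _ _
    (openOver_hom_ext _ _) (openOver_hom_ext _ _) (openOver_hom_ext _ _)).trans
    (congrArg (_ ≪≫ ·) (Fibred.pullIso_trans _ (D.phiOn i j V h) f _ _ _
      (openOver_hom_ext _ _) (openOver_hom_ext _ _) (openOver_hom_ext _ _)))).symm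

/-- The sections `λᵢⱼ` of `Aut(G)` over `Uᵢⱼ`, with `λᵢⱼ(g) = φᵢⱼ ∘ g ∘ φᵢⱼ⁻¹`. -/
def lam (i j : I) : AutForm G 0 (U i ⊓ U j) where
  val s h := D.lamOn i j (Over.mk (s.pt 0)) (h 0)
  val_pull f s _ g :=
    D.lamOn_pull i j (Over.homMk f rfl : Over.mk (f ≫ s.pt 0) ⟶ Over.mk (s.pt 0)) _ _ g
  val_degenerate _ _ a := a.elim0

/-- The automorphism `g ↦ γᵢ ∘ ε(g) ∘ γᵢ⁻¹` of the sections of `G` at a point of `Δ¹`. -/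
def mOn (i : I) (e : InfPair X) (h : e.simplex.In (U i)) : (e.base ⟶ G) ≃* (e.base ⟶ G) :=
  have := C.isEquivalence e
  ((D.bandOn i ((InfPair.vertex 1).obj e) (h 1)).trans
    ((Functor.FullyFaithful.ofFullyFaithful
      (C.ε.fiber e)).autMulEquivOfFullyFaithful _)).trans
    ((D.gam i e h).conjAut.trans (D.bandOn i ((InfPair.vertex 0).obj e) (h 0)).symm)

lemma bandOn_mOn (i : I) (e : InfPair X) (h : e.simplex.In (U i)) (g : e.base ⟶ G) :
    D.bandOn i ((InfPair.vertex 0).obj e) (h 0) (D.mOn i e h g) =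
      (D.gam i e h).symm ≪≫
        (C.ε.fiber e).mapIso (D.bandOn i ((InfPair.vertex 1).obj e) (h 1) g) ≪≫ D.gam i e h := by
  exact (MulEquiv.apply_symm_apply (D.bandOn i ((InfPair.vertex 0).obj e) (h 0)) _).trans
    (Iso.conjAut_apply _ _)

lemma gam_mOn (i : I) (e : InfPair X) (h : e.simplex.In (U i)) (g : e.base ⟶ G) :
    (D.gam i e h).hom ≫ (D.bandOn i ((InfPair.vertex 0).obj e) (h 0) (D.mOn i e h g)).hom =
      (C.ε.fiber e).map (D.bandOn i ((InfPair.vertex 1).obj e) (h 1) g).hom ≫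
        (D.gam i e h).hom := by
  rw [bandOn_mOn]
  exact Iso.hom_inv_id_assoc _ _

lemma mOn_pull (i : I) {e e' : InfPair X} (f : e' ⟶ e) (h : e.simplex.In (U i))
    (h' : e'.simplex.In (U i)) (g : e.base ⟶ G) :
    D.mOn i e' h' (f.1 ≫ g) = f.1 ≫ D.mOn i e h g := by
  apply (D.bandOn i ((InfPair.vertex 0).obj e') (h' 0)).injective
  apply Iso.ext
  rw [← cancel_epi (D.gam i e' h').hom, gam_mOn]
  have h0 := D.bandOn_pull i ((InfPair.vertex 0).map f) (h 0) (h' 0) (D.mOn i e h g)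
  have h1 := D.bandOn_pull i ((InfPair.vertex 1).map f) (h 1) (h' 1) g
  replace h0 := congrArg Iso.hom h0
  replace h1 := congrArg Iso.hom h1
  refine (congrArg (fun a => (C.ε.fiber e').map a ≫ (D.gam i e' h').hom) h1).trans
    (Eq.trans ?_ (congrArg (fun a => (D.gam i e' h').hom ≫ a) h0).symm)
  rw [D.gam_pull i f h h']
  refine (C.ε.pullArrow_map_comp f _ _ _ _ _
    (openOver_hom_ext _ _) (openOver_hom_ext _ _) (openOver_hom_ext _ _)).symm.trans
    (Eq.trans ?_ (C.ε.pullArrow_comp f _ _ _ _ _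
    (openOver_hom_ext _ _) (openOver_hom_ext _ _) (openOver_hom_ext _ _)))
  rw [gam_mOn]

lemma mOn_diag (i : I) (V : Over X) (h : (InfPair.diag.obj V).simplex.In (U i))
    (g : V.left ⟶ G) : D.mOn i (InfPair.diag.obj V) h g = g := by
  apply (D.bandOn i V (h 0)).injective
  apply Iso.ext
  have h1 := D.gam_mOn i (InfPair.diag.obj V) h g
  rw [D.gam_diag i V h] at h1
  have h2 := (C.unit V).hom.naturality (D.bandOn i V (h 0) g).hom
  exact (cancel_epi ((C.unit V).hom.app (D.objOn i V (h 0)))).1 (h1.trans h2)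

/-- The `Aut(G)`-valued 1-forms `mᵢ` on `Uᵢ`, with `mᵢ(g) = γᵢ ∘ ε(g) ∘ γᵢ⁻¹`. -/
def m (i : I) : AutForm G 1 (U i) where
  val {T} s h := D.mOn i ⟨T, s⟩ h
  val_pull {T T'} f s h g :=
    D.mOn_pull i (e := ⟨T, s⟩) (e' := ⟨T', s.pull f⟩) ⟨f, rfl⟩ h (h.pull f) g
  val_degenerate {T} s h a ha := by
    have hs := Simplex.eq_const ha
    generalize s.pt 0 = x at hs
    subst hs
    exact MulEquiv.ext fun g => D.mOn_diag i (Over.mk x) h g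

/-- The value of `γᵢⱼ` at a point of `Δ¹`: the section of `G` with `γᵢⱼ ∘ p₀^* φᵢⱼ ∘ γⱼ = γᵢ ∘ ε(p₁^* φᵢⱼ)`. -/
def gammaOn (i j : I) (e : InfPair X) (h : e.simplex.In (U i ⊓ U j)) : e.base ⟶ G :=
  (D.bandOn i ((InfPair.vertex 0).obj e) ((h 0).trans inf_le_left)).symm
    ((D.phiOn i j ((InfPair.vertex 0).obj e) (h 0)).symm ≪≫
      (D.gam j e (h.mono inf_le_right)).symm ≪≫
      (C.ε.fiber e).mapIso (D.phiOn i j ((InfPair.vertex 1).obj e) (h 1)) ≪≫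
      D.gam i e (h.mono inf_le_left))

lemma gam_gammaOn (i j : I) (e : InfPair X) (h : e.simplex.In (U i ⊓ U j)) :
    (D.gam j e (h.mono inf_le_right)).hom ≫
      (D.phiOn i j ((InfPair.vertex 0).obj e) (h 0)).hom ≫
        (D.bandOn i ((InfPair.vertex 0).obj e) ((h 0).trans inf_le_left)
          (D.gammaOn i j e h)).hom =
      (C.ε.fiber e).map (D.phiOn i j ((InfPair.vertex 1).obj e) (h 1)).hom ≫
        (D.gam i e (h.mono inf_le_left)).hom := by
  have e0 := MulEquiv.apply_symm_apply
    (D.bandOn i ((InfPair.vertex 0).obj e) ((h 0).trans inf_le_left))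
    ((D.phiOn i j ((InfPair.vertex 0).obj e) (h 0)).symm ≪≫
      (D.gam j e (h.mono inf_le_right)).symm ≪≫
      (C.ε.fiber e).mapIso (D.phiOn i j ((InfPair.vertex 1).obj e) (h 1)) ≪≫
      D.gam i e (h.mono inf_le_left))
  refine (congrArg (fun a : Aut _ => (D.gam j e (h.mono inf_le_right)).hom ≫
      (D.phiOn i j ((InfPair.vertex 0).obj e) (h 0)).hom ≫ a.hom) e0).trans ?_
  simp

lemma gammaOn_pull (i j : I) {e e' : InfPair X} (f : e' ⟶ e) (h : e.simplex.In (U i ⊓ U j))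
    (h' : e'.simplex.In (U i ⊓ U j)) : D.gammaOn i j e' h' = f.1 ≫ D.gammaOn i j e h := by
  apply (D.bandOn i ((InfPair.vertex 0).obj e') ((h' 0).trans inf_le_left)).injective
  apply Iso.ext
  rw [← cancel_epi (D.phiOn i j ((InfPair.vertex 0).obj e') (h' 0)).hom,
    ← cancel_epi (D.gam j e' (h'.mono inf_le_right)).hom, gam_gammaOn]
  have h0 := congrArg Iso.hom (D.bandOn_pull i ((InfPair.vertex 0).map f)
    ((h 0).trans inf_le_left) ((h' 0).trans inf_le_left) (D.gammaOn i j e h))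
  have p0 := congrArg Iso.hom (D.phiOn_pull i j ((InfPair.vertex 0).map f) (h 0) (h' 0))
  have p1 := congrArg Iso.hom (D.phiOn_pull i j ((InfPair.vertex 1).map f) (h 1) (h' 1))
  refine Eq.trans ?_ (congrArg (fun a => (D.gam j e' (h'.mono inf_le_right)).hom ≫
    (D.phiOn i j ((InfPair.vertex 0).obj e') (h' 0)).hom ≫ a) h0).symm
  rw [p0, p1, D.gam_pull j f (h.mono inf_le_right), D.gam_pull i f (h.mono inf_le_left)]
  refine (C.ε.pullArrow_map_comp f _ _ _ _ _
    (openOver_hom_ext _ _) (openOver_hom_ext _ _) (openOver_hom_ext _ _)).symm.trans ?_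
  refine Eq.trans ?_ (congrArg (_ ≫ ·) (Fibred.pullHom_comp _ _ _ _ _ _
    (openOver_hom_ext _ _) (openOver_hom_ext _ _) (openOver_hom_ext _ _)).symm)
  refine Eq.trans ?_ (C.ε.pullArrow_comp f _ _ _ _ _
    (openOver_hom_ext _ _) (openOver_hom_ext _ _) (openOver_hom_ext _ _))
  rw [gam_gammaOn]

lemma gammaOn_diag (i j : I) (V : Over X) (h : (InfPair.diag.obj V).simplex.In (U i ⊓ U j)) :
    D.gammaOn i j (InfPair.diag.obj V) h = 1 := by
  apply (D.bandOn i V ((h 0).trans inf_le_left)).injective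
  refine Eq.trans (Iso.ext ?_) (map_one (D.bandOn i V ((h 0).trans inf_le_left))).symm
  have h1 := D.gam_gammaOn i j (InfPair.diag.obj V) h
  rw [D.gam_diag i V (h.mono inf_le_left), D.gam_diag j V (h.mono inf_le_right)] at h1
  have h2 := (C.unit V).hom.naturality (D.phiOn i j V (h 0)).hom
  have h3 := (cancel_epi ((C.unit V).hom.app (D.objOn j V ((h 0).trans inf_le_right)))).1
    (h1.trans h2)
  exact (cancel_epi (D.phiOn i j V (h 0)).hom).1 (h3.trans (Category.comp_id _).symm)

/-- The `G`-valued 1-forms `γᵢⱼ` on `Uᵢⱼ`, with `γᵢⱼ ∘ p₀^* φᵢⱼ ∘ γⱼ = γᵢ ∘ ε(p₁^* φᵢⱼ)`. -/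
def gamma (i j : I) : GForm G 1 (U i ⊓ U j) where
  val {T} s h := D.gammaOn i j ⟨T, s⟩ h
  val_pull {T T'} f s h :=
    D.gammaOn_pull i j (e := ⟨T, s⟩) (e' := ⟨T', s.pull f⟩) ⟨f, rfl⟩ h (h.pull f)
  val_degenerate {T} s h a ha := by
    have hs := Simplex.eq_const ha
    generalize s.pt 0 = x at hs
    subst hs
    exact D.gammaOn_diag i j (Over.mk x) h

end LocalData

/-! ### The twisted Čech differential -/

section Cech

variable {G : Over S} [GrpObj G] {X : Over S} {I : Type*} {U : I → X.left.Opens}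

/-- `λᵢⱼₖ = λᵢⱼ λⱼₖ λᵢₖ⁻¹` over `Uᵢⱼₖ`. -/
def lam3 (l : ∀ i j, AutForm G 0 (U i ⊓ U j)) (i j k : I) : AutForm G 0 (U i ⊓ U j ⊓ U k) :=
  (l i j).restrict inf_le_left *
    (l j k).restrict (le_inf (inf_le_left.trans inf_le_right) inf_le_right) *
    ((l i k).restrict (le_inf (inf_le_left.trans inf_le_left) inf_le_right))⁻¹

/-- The twisted Čech differential of a 1-cochain with values in `G`-valued `n`-forms, additively
`δ¹(ω)ᵢⱼₖ = ωᵢⱼ + λᵢⱼ(ωⱼₖ) - λᵢⱼₖ(ωᵢₖ)`. -/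
def cech1 (l : ∀ i j, AutForm G 0 (U i ⊓ U j)) {n : ℕ} (ω : ∀ i j, GForm G n (U i ⊓ U j))
    (i j k : I) : GForm G n (U i ⊓ U j ⊓ U k) :=
  (ω i j).restrict inf_le_left *
    ((l i j).restrict inf_le_left).act
      ((ω j k).restrict (le_inf (inf_le_left.trans inf_le_right) inf_le_right)) *
    ((lam3 l i j k).act
      ((ω i k).restrict (le_inf (inf_le_left.trans inf_le_left) inf_le_right)))⁻¹

/-- The twisted de Rham differential of a 1-cochain with values in 1-forms, additively
`(d¹ω)ᵢⱼ = dωᵢⱼ + ½[ωᵢⱼ, ωᵢⱼ] + [mᵢ, ωᵢⱼ]`. -/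
def deRham1 (m : ∀ i, AutForm G 1 (U i)) (ω : ∀ i j, GForm G 1 (U i ⊓ U j))
    (i j : I) : GForm G 2 (U i ⊓ U j) :=
  ((m i).restrict inf_le_left).d1 (ω i j)

end Cech

end GerbeForms

end

/-!
Write `a₁ = ω(x, y)`, `a₂ = m(x, y)(ω(y, z))` and `a₃ = ω(x, z)` for the constituents of `d¹ₘ ω`
at an infinitesimal 2-simplex.

The only geometric input is that, for close `T`-valued points `x` and `y` of `X`, any two
`T`-valued points of `G` which are trivial on the locus `x = y` commute (`Close.mul_comm_of_mem`).
Locally on `T` this locus contains the zero locus of an ideal of square zero, and the kernel of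
`G(R) → G(R ⧸ I)` is commutative when `I ^ 2 = 0` (`SquareZero.mul_comm_of_trivial_mod`): an
Eckmann–Hilton argument over the extension of `R` by `I ⊕ I`. In particular 1-forms commute, `a₁`
lies in the commutative normal subgroup `K` attached to `(x, y)`, `a₂` in the one `L` attached to
`(y, z)`, and the values of 2-forms in `K ⊓ L`, which is central in the subgroup generated by `K`
and `L`. Group theory then gives the product rule `d¹ₘ(a + b) = d¹ₘ(a) + d¹ₘ'(b)`, where `m' =
Ad(a) ∘ m` (`AutForm.d1_mul`).

The definition of `γᵢⱼ` says that `λᵢⱼ(x) ∘ mⱼ(x, y) = Ad(ωᵢⱼ(x, y)) ∘ mᵢ(x, y) ∘ λᵢⱼ(y)` for `ωᵢⱼ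
= -γᵢⱼ` (`LocalData.lam_intertwines`). It follows that `λᵢⱼₖ` carries `mᵢ` to `Ad(c) ∘ mᵢ`, where
`c = δ¹(ω)ᵢⱼₖ` (`lam3_intertwines`). Put `a = ωᵢⱼ`, `b = λᵢⱼ(ωⱼₖ)` and `e = λᵢⱼₖ(ωᵢₖ)`, so that `c
+ e = a + b`. The product rule computes the differential of this 1-form in two ways: as `d¹(c) +
λᵢⱼₖ(d¹ωᵢₖ)` and as `d¹(a) + λᵢⱼ(d¹ωⱼₖ)`. Comparing the two gives the claim (`d1_cech1`).
-/

noncomputable section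

/-! ### Points of group schemes modulo an ideal of square zero -/

namespace SquareZero

/-- For an ideal `I` of `R`, the triples of elements of `R` with the same class modulo `I`. If
`I ^ 2 = 0` this is the square-zero extension of `R` by `I ⊕ I`, with `r + (i, j)` written as
`(r, r + i, r + j)`. -/
def triples {R : Type u} [CommRing R] (I : Ideal R) : Subring (R × R × R) where
  carrier := {x | x.2.1 - x.1 ∈ I ∧ x.2.2 - x.1 ∈ I}
  mul_mem' := by
    rintro ⟨r, s, t⟩ ⟨r', s', t'⟩ ⟨h1, h2⟩ ⟨h1', h2'⟩
    refine ⟨?_, ?_⟩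
    · have := I.add_mem (I.mul_mem_left s h1') (I.mul_mem_left r' h1)
      simp only [Prod.mk_mul_mk] at this ⊢
      convert this using 1; ring
    · have := I.add_mem (I.mul_mem_left t h2') (I.mul_mem_left r' h2)
      simp only [Prod.mk_mul_mk] at this ⊢
      convert this using 1; ring
  one_mem' := by simp
  add_mem' := by
    rintro ⟨r, s, t⟩ ⟨r', s', t'⟩ ⟨h1, h2⟩ ⟨h1', h2'⟩
    refine ⟨?_, ?_⟩
    · have := I.add_mem h1 h1'
      simp only [Prod.mk_add_mk] at this ⊢
      convert this using 1; ring
    · have := I.add_mem h2 h2'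
      simp only [Prod.mk_add_mk] at this ⊢
      convert this using 1; ring
  zero_mem' := by simp
  neg_mem' := by
    rintro ⟨r, s, t⟩ ⟨h1, h2⟩
    refine ⟨?_, ?_⟩
    · have := I.neg_mem h1
      simp only [Prod.neg_mk] at this ⊢
      convert this using 1; ring
    · have := I.neg_mem h2
      simp only [Prod.neg_mk] at this ⊢
      convert this using 1; ring

variable {R : Type u} [CommRing R] (I : Ideal R)

/-- The first component of a triple. -/
def tripleFst : triples I →+* R := (RingHom.fst R (R × R)).comp (triples I).subtype

/-- The second component of a triple. -/
def tripleSnd : triples I →+* R :=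
  ((RingHom.fst R R).comp (RingHom.snd R (R × R))).comp (triples I).subtype

/-- The third component of a triple. -/
def tripleThd : triples I →+* R :=
  ((RingHom.snd R R).comp (RingHom.snd R (R × R))).comp (triples I).subtype

/-- The constant triples. -/
def tripleDiag : R →+* triples I :=
  ((RingHom.id R).prod ((RingHom.id R).prod (RingHom.id R))).codRestrict _ (by
    intro r; simp [triples])

/-- The sum `r + (i, j) ↦ r + i + j`, which is a ring homomorphism when `I ^ 2 = 0`. -/
def tripleSum {I : Ideal R} (hI : ∀ a ∈ I, ∀ b ∈ I, a * b = 0) : triples I →+* R where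
  toFun x := x.1.2.1 + x.1.2.2 - x.1.1
  map_one' := by simp
  map_zero' := by simp
  map_add' x y := by simp; ring
  map_mul' x y := by
    have h1 := hI _ x.2.1 _ y.2.2
    have h2 := hI _ x.2.2 _ y.2.1
    simp only [Subring.coe_mul, Prod.fst_mul, Prod.snd_mul]
    linear_combination -h1 - h2

/-- A surjection whose kernel consists of elements of square zero induces a surjection on
spectra. -/
lemma specMap_surjective {A B : Type u} [CommRing A] [CommRing B] (f : A →+* B)
    (hf : Function.Surjective f) (h : ∀ a, f a = 0 → a * a = 0) :
    Function.Surjective (Spec.map (CommRingCat.ofHom f)) := by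
  have h' : Function.Surjective (PrimeSpectrum.comap f) := by
    rw [← Set.range_eq_univ, range_comap_of_surjective _ _ hf,
      Set.eq_univ_iff_forall]
    intro p a ha
    exact p.2.mem_of_pow_mem 2 (by rw [pow_two, h a ha]; exact p.asIdeal.zero_mem)
  exact h'

lemma exists_specMap_fromSpec {A : CommRingCat.{u}} {Y : Scheme.{u}} (φ : Spec A ⟶ Y)
    {U : Y.Opens} (hU : IsAffineOpen U) (h : Set.range φ ⊆ U) :
    ∃ a : Γ(Y, U) ⟶ A, φ = Spec.map a ≫ hU.fromSpec := by
  have h' : Set.range φ ⊆ Set.range hU.fromSpec := by rwa [hU.range_fromSpec]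
  refine ⟨Spec.preimage (IsOpenImmersion.lift hU.fromSpec φ h'), ?_⟩
  rw [Spec.map_preimage, IsOpenImmersion.lift_fac]

lemma range_subset_of_comp {A B : Type u} [CommRing A] [CommRing B] (f : A →+* B)
    (hf : Function.Surjective (Spec.map (CommRingCat.ofHom f))) {Y : Scheme.{u}}
    (φ ψ : Spec (.of A) ⟶ Y)
    (h : Spec.map (CommRingCat.ofHom f) ≫ φ = Spec.map (CommRingCat.ofHom f) ≫ ψ)
    {U : Set Y} (hU : Set.range φ ⊆ U) : Set.range ψ ⊆ U := by
  rintro _ ⟨x, rfl⟩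
  obtain ⟨y, rfl⟩ := hf x
  rw [← Scheme.Hom.comp_apply, ← h]
  exact hU ⟨_, rfl⟩

lemma tripleFst_surjective : Function.Surjective (tripleFst I) := fun r => ⟨tripleDiag I r, rfl⟩

lemma mul_self_eq_zero_of_tripleFst {I : Ideal R} (hI : ∀ a ∈ I, ∀ b ∈ I, a * b = 0) (x : triples I)
    (hx : tripleFst I x = 0) : x * x = 0 := by
  obtain ⟨⟨r, s, t⟩, h1, h2⟩ := x
  replace hx : r = 0 := hx
  subst hx
  simp only [sub_zero] at h1 h2
  apply Subtype.ext
  exact Prod.ext (mul_zero _) (Prod.ext (hI _ h1 _ h1) (hI _ h2 _ h2))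

/-- Morphisms from the spectrum of the ring of triples to a scheme are determined by their
three components. -/
lemma specTriples_hom_ext {I : Ideal R} (hI : ∀ a ∈ I, ∀ b ∈ I, a * b = 0) {Y : Scheme.{u}}
    {U : Y.Opens} (hU : IsAffineOpen U) (φ ψ : Spec (.of (triples I)) ⟶ Y)
    (h : Set.range (Spec.map (CommRingCat.ofHom (tripleFst I)) ≫ φ) ⊆ U)
    (h1 : Spec.map (CommRingCat.ofHom (tripleFst I)) ≫ φ =
      Spec.map (CommRingCat.ofHom (tripleFst I)) ≫ ψ)
    (h2 : Spec.map (CommRingCat.ofHom (tripleSnd I)) ≫ φ =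
      Spec.map (CommRingCat.ofHom (tripleSnd I)) ≫ ψ)
    (h3 : Spec.map (CommRingCat.ofHom (tripleThd I)) ≫ φ =
      Spec.map (CommRingCat.ofHom (tripleThd I)) ≫ ψ) :
    φ = ψ := by
  have hs := specMap_surjective _ (tripleFst_surjective I) (mul_self_eq_zero_of_tripleFst hI)
  have hφ : Set.range φ ⊆ U := by
    rintro _ ⟨x, rfl⟩
    obtain ⟨y, rfl⟩ := hs x
    exact h ⟨y, Scheme.Hom.comp_apply _ _ _⟩
  obtain ⟨a, rfl⟩ := exists_specMap_fromSpec φ hU hφ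
  obtain ⟨b, rfl⟩ := exists_specMap_fromSpec ψ hU (range_subset_of_comp _ hs _ _ h1 hφ)
  simp only [← Category.assoc, ← Spec.map_comp, cancel_mono, Spec.map_inj] at h1 h2 h3
  congr 2
  refine CommRingCat.hom_ext (RingHom.ext fun x => Subtype.ext ?_)
  exact Prod.ext (congr($(h1) x)) (Prod.ext (congr($(h2) x)) (congr($(h3) x)))

/-- Three morphisms from `Spec R` which agree on `Spec (R ⧸ I)` define a morphism from the
spectrum of the ring of triples. If one of the last two is equal to the first, then composition
with the sum recovers the other. -/
lemma exists_specTriples_hom {I : Ideal R} (hI : ∀ a ∈ I, ∀ b ∈ I, a * b = 0) {Y : Scheme.{u}}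
    {U : Y.Opens} (hU : IsAffineOpen U) (φ₀ φ₁ φ₂ : Spec (.of R) ⟶ Y) (h : Set.range φ₀ ⊆ U)
    (h1 : Spec.map (CommRingCat.ofHom (Ideal.Quotient.mk I)) ≫ φ₀ =
      Spec.map (CommRingCat.ofHom (Ideal.Quotient.mk I)) ≫ φ₁)
    (h2 : Spec.map (CommRingCat.ofHom (Ideal.Quotient.mk I)) ≫ φ₀ =
      Spec.map (CommRingCat.ofHom (Ideal.Quotient.mk I)) ≫ φ₂) :
    ∃ Φ : Spec (.of (triples I)) ⟶ Y,
      Spec.map (CommRingCat.ofHom (tripleFst I)) ≫ Φ = φ₀ ∧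
      Spec.map (CommRingCat.ofHom (tripleSnd I)) ≫ Φ = φ₁ ∧
      Spec.map (CommRingCat.ofHom (tripleThd I)) ≫ Φ = φ₂ ∧
      (φ₂ = φ₀ → Spec.map (CommRingCat.ofHom (tripleSum hI)) ≫ Φ = φ₁) ∧
      (φ₁ = φ₀ → Spec.map (CommRingCat.ofHom (tripleSum hI)) ≫ Φ = φ₂) := by
  have hs := specMap_surjective (Ideal.Quotient.mk I) Ideal.Quotient.mk_surjective fun a ha =>
    hI a (Ideal.Quotient.eq_zero_iff_mem.1 ha) a (Ideal.Quotient.eq_zero_iff_mem.1 ha)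
  obtain ⟨a₀, rfl⟩ := exists_specMap_fromSpec φ₀ hU h
  obtain ⟨a₁, rfl⟩ := exists_specMap_fromSpec φ₁ hU (range_subset_of_comp _ hs _ _ h1 h)
  obtain ⟨a₂, rfl⟩ := exists_specMap_fromSpec φ₂ hU (range_subset_of_comp _ hs _ _ h2 h)
  simp only [← Category.assoc, ← Spec.map_comp, cancel_mono, Spec.map_inj] at h1 h2
  have h1' (x) : a₁ x - a₀ x ∈ I := Ideal.Quotient.eq.1 congr($(h1) x).symm
  have h2' (x) : a₂ x - a₀ x ∈ I := Ideal.Quotient.eq.1 congr($(h2) x).symm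
  let b : Γ(Y, U) →+* triples I :=
    (a₀.hom.prod (a₁.hom.prod a₂.hom)).codRestrict _ fun x => ⟨h1' x, h2' x⟩
  refine ⟨Spec.map (CommRingCat.ofHom b) ≫ hU.fromSpec, ?_, ?_, ?_, ?_, ?_⟩
  · rw [← Category.assoc, ← Spec.map_comp]; rfl
  · rw [← Category.assoc, ← Spec.map_comp]; rfl
  · rw [← Category.assoc, ← Spec.map_comp]; rfl
  · intro h
    rw [cancel_mono, Spec.map_inj] at h
    subst h
    rw [← Category.assoc, ← Spec.map_comp]
    congr 2
    ext x
    exact add_sub_cancel_right _ _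
  · intro h
    rw [cancel_mono, Spec.map_inj] at h
    subst h
    rw [← Category.assoc, ← Spec.map_comp]
    congr 2
    ext x
    exact add_sub_cancel_left _ _

/-- Let `I` be an ideal of square zero of `R`. Then two `R`-valued points of a group scheme which
are trivial modulo `I` commute. With `g` and `h` regarded as tangent vectors at the unit, there is a
point of `G` over the ring of triples with components `(1, g, 1)` and another one with components
`(1, 1, h)`. These commute because they do so componentwise, and their images under the sum of
tangent vectors are `g` and `h`. -/
lemma mul_comm_of_trivial_mod {I : Ideal R} (hI : ∀ a ∈ I, ∀ b ∈ I, a * b = 0) {S : Scheme.{u}}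
    (G : Over S) [GrpObj G] (f : Spec (.of R) ⟶ S) (g h : Over.mk f ⟶ G)
    (hg : Spec.map (CommRingCat.ofHom (Ideal.Quotient.mk I)) ≫ (1 : Over.mk f ⟶ G).left =
      Spec.map (CommRingCat.ofHom (Ideal.Quotient.mk I)) ≫ g.left)
    (hh : Spec.map (CommRingCat.ofHom (Ideal.Quotient.mk I)) ≫ (1 : Over.mk f ⟶ G).left =
      Spec.map (CommRingCat.ofHom (Ideal.Quotient.mk I)) ≫ h.left)
    {U : G.left.Opens} (hU : IsAffineOpen U) {V : S.Opens} (hV : IsAffineOpen V)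
    (h1 : Set.range (1 : Over.mk f ⟶ G).left ⊆ U) (hf : Set.range f ⊆ V) : g * h = h * g := by
  have w (k : Over.mk f ⟶ G) : k.left ≫ G.hom = f := Over.w k
  let T : Over S := Over.mk (Spec.map (CommRingCat.ofHom (tripleDiag I)) ≫ f)
  have hd (p : triples I →+* R) (hp : p.comp (tripleDiag I) = RingHom.id R) :
      Spec.map (CommRingCat.ofHom p) ≫ Spec.map (CommRingCat.ofHom (tripleDiag I)) ≫ f = f := by
    rw [← Category.assoc, ← Spec.map_comp, ← CommRingCat.ofHom_comp, hp]
    exact (congrArg (· ≫ f) (Spec.map_id _)).trans (Category.id_comp f)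
  have d0 := hd (tripleFst I) rfl
  have d1 := hd (tripleSnd I) rfl
  have d2 := hd (tripleThd I) rfl
  have ds := hd (tripleSum hI) (RingHom.ext fun x => add_sub_cancel_right x x)
  let p0 : Over.mk f ⟶ T := Over.homMk (Spec.map (CommRingCat.ofHom (tripleFst I))) d0
  let p1 : Over.mk f ⟶ T := Over.homMk (Spec.map (CommRingCat.ofHom (tripleSnd I))) d1
  let p2 : Over.mk f ⟶ T := Over.homMk (Spec.map (CommRingCat.ofHom (tripleThd I))) d2
  let ps : Over.mk f ⟶ T := Over.homMk (Spec.map (CommRingCat.ofHom (tripleSum hI))) ds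
  have lift (k₁ k₂ : Over.mk f ⟶ G)
      (e1 : Spec.map (CommRingCat.ofHom (Ideal.Quotient.mk I)) ≫ (1 : Over.mk f ⟶ G).left =
        Spec.map (CommRingCat.ofHom (Ideal.Quotient.mk I)) ≫ k₁.left)
      (e2 : Spec.map (CommRingCat.ofHom (Ideal.Quotient.mk I)) ≫ (1 : Over.mk f ⟶ G).left =
        Spec.map (CommRingCat.ofHom (Ideal.Quotient.mk I)) ≫ k₂.left) :
      ∃ Φ : T ⟶ G, p0 ≫ Φ = 1 ∧ p1 ≫ Φ = k₁ ∧ p2 ≫ Φ = k₂ ∧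
        (k₂ = 1 → ps ≫ Φ = k₁) ∧ (k₁ = 1 → ps ≫ Φ = k₂) := by
    obtain ⟨Φ, c0, c1, c2, c3, c4⟩ := exists_specTriples_hom hI hU _ _ _ h1 e1 e2
    have hΦ : Φ ≫ G.hom = Spec.map (CommRingCat.ofHom (tripleDiag I)) ≫ f := by
      apply specTriples_hom_ext hI hV
      · rw [← Category.assoc, c0, w]; exact hf
      · rw [← Category.assoc, c0, w, d0]
      · rw [← Category.assoc, c1, w, d1]
      · rw [← Category.assoc, c2, w, d2]
    refine ⟨Over.homMk Φ hΦ, Over.OverMorphism.ext c0, Over.OverMorphism.ext c1,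
      Over.OverMorphism.ext c2, fun h => Over.OverMorphism.ext (c3 (congrArg (·.left) h)),
      fun h => Over.OverMorphism.ext (c4 (congrArg (·.left) h))⟩
  obtain ⟨Φ, a0, a1, a2, a3, -⟩ := lift g 1 hg rfl
  obtain ⟨Ψ, b0, b1, b2, -, b3⟩ := lift 1 h rfl hh
  -- In each of the three components one of the two factors is trivial.
  have key : Φ * Ψ = Ψ * Φ := by
    have q0 : p0 ≫ (Φ * Ψ) = p0 ≫ (Ψ * Φ) := by
      rw [MonObj.comp_mul, MonObj.comp_mul, a0, b0]
    have q1 : p1 ≫ (Φ * Ψ) = p1 ≫ (Ψ * Φ) := by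
      rw [MonObj.comp_mul, MonObj.comp_mul, a1, b1, mul_one, one_mul]
    have q2 : p2 ≫ (Φ * Ψ) = p2 ≫ (Ψ * Φ) := by
      rw [MonObj.comp_mul, MonObj.comp_mul, a2, b2, mul_one, one_mul]
    refine Over.OverMorphism.ext (specTriples_hom_ext hI hU _ _ ?_ (congrArg (·.left) q0)
      (congrArg (·.left) q1) (congrArg (·.left) q2))
    have : p0 ≫ (Φ * Ψ) = 1 := by rw [MonObj.comp_mul, a0, b0, one_mul]
    have := congrArg (·.left) this
    exact (congrArg (fun k : Spec (.of R) ⟶ G.left => Set.range k) this).subset.trans h1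
  have := congrArg (ps ≫ ·) key
  simp only [MonObj.comp_mul] at this
  rwa [a3 rfl, b3 rfl] at this

end SquareZero

/-! ### Points which are trivial where two close points coincide -/

namespace GerbeForms

variable {S : Scheme.{u}}

lemma exists_spec_quotient_hom {Y : Scheme.{u}} (J : Y.IdealSheafData) {Q : Y.Opens}
    (hQ : IsAffineOpen Q) :
    ∃ r : Spec (.of (Γ(Y, Q) ⧸ J.ideal ⟨Q, hQ⟩)) ⟶ J.subscheme, r ≫ J.subschemeι =
      Spec.map (CommRingCat.ofHom (Ideal.Quotient.mk (J.ideal ⟨Q, hQ⟩))) ≫ hQ.fromSpec :=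
  ⟨J.subschemeCover.f ⟨Q, hQ⟩, (J.subschemeCover_map_subschemeι ⟨Q, hQ⟩).trans
    ((Category.assoc _ _ _).trans (congrArg (_ ≫ ·) hQ.isoSpec_inv_ι))⟩

/-- A morphism from `T` to the first-order neighbourhood of a closed subscheme `Z` factors through
`Z` modulo an ideal of square zero, locally on `T`. -/
lemma exists_squareZero_factor {Z Y T : Scheme.{u}} (c : Z ⟶ Y) [IsClosedImmersion c]
    (k : T ⟶ (c.ker ^ 2).subscheme) (t : T) (N : T.Opens) (ht : t ∈ N) :
    ∃ (W : T.Opens) (hW : IsAffineOpen W) (I : Ideal Γ(T, W)),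
      t ∈ W ∧ W ≤ N ∧ (∀ a ∈ I, ∀ b ∈ I, a * b = 0) ∧
      ∃ z : Spec (.of (Γ(T, W) ⧸ I)) ⟶ Z,
        (Spec.map (CommRingCat.ofHom (Ideal.Quotient.mk I)) ≫ hW.fromSpec) ≫
          k ≫ (c.ker ^ 2).subschemeι = z ≫ c := by
  obtain ⟨Q, hQ, htQ, -⟩ := exists_isAffineOpen_mem_and_subset
    (X := Y) (x := (k ≫ (c.ker ^ 2).subschemeι) t) (U := ⊤) trivial
  obtain ⟨W, hW, htW, hWN⟩ := exists_isAffineOpen_mem_and_subset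
    (X := T) (x := t) (U := N ⊓ (k ≫ (c.ker ^ 2).subschemeι) ⁻¹ᵁ Q) ⟨ht, htQ⟩
  have hWQ : W ≤ (k ≫ (c.ker ^ 2).subschemeι) ⁻¹ᵁ Q := fun _ h => (hWN h).2
  let J : Ideal Γ(Y, Q) := c.ker.ideal ⟨Q, hQ⟩
  let a : Γ(Y, Q) ⟶ Γ(T, W) := (k ≫ (c.ker ^ 2).subschemeι).appLE Q W hWQ
  have ha (z : Γ(Y, Q)) (hz : z ∈ J ^ 2) : a z = 0 := by
    have h0 : (c.ker ^ 2).subschemeι.app Q z = 0 := by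
      rw [← RingHom.mem_ker]
      exact ((c.ker ^ 2).ker_subschemeι_app ⟨Q, hQ⟩).ge hz
    simp only [a, Scheme.Hom.appLE, Scheme.Hom.comp_app]
    change T.presheaf.map _ (k.app _ ((c.ker ^ 2).subschemeι.app Q z)) = 0
    rw [h0, map_zero, map_zero]
  -- The ideal of the preimage of `Z` in `W`; its square is generated by the image of `J ^ 2`.
  let I : Ideal Γ(T, W) := J.map a.hom
  have hI : I * I = ⊥ := by
    rw [← Ideal.map_mul, ← pow_two, Ideal.map_eq_bot_iff_le_ker]
    exact ha
  refine ⟨W, hW, I, htW, fun _ h => (hWN h).1, fun b hb c hc => ?_, ?_⟩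
  · have := Ideal.mul_mem_mul hb hc
    rwa [hI] at this
  obtain ⟨r, hr⟩ := exists_spec_quotient_hom c.ker hQ
  let b : Γ(Y, Q) ⧸ J →+* Γ(T, W) ⧸ I := Ideal.quotientMap I a.hom Ideal.le_comap_map
  have e : inv c.toImage ≫ c = c.ker.subschemeι := (IsIso.inv_comp_eq _).2 c.toImage_imageι.symm
  refine ⟨Spec.map (CommRingCat.ofHom b) ≫ r ≫ inv c.toImage, ?_⟩
  rw [Category.assoc, Category.assoc, Category.assoc, e, hr,
    ← IsAffineOpen.SpecMap_appLE_fromSpec _ hQ hW hWQ, ← Spec.map_comp_assoc]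
  exact Spec.map_comp_assoc (CommRingCat.ofHom (Ideal.Quotient.mk J)) (CommRingCat.ofHom b) _

/-- Locally on `T`, two close `T`-valued points become equal modulo an ideal of square zero. -/
lemma Close.exists_squareZero {X T : Over S} {x y : T ⟶ X} (hxy : Close x y) (t : T.left)
    (N : T.left.Opens) (ht : t ∈ N) :
    ∃ (W : T.left.Opens) (hW : IsAffineOpen W) (I : Ideal Γ(T.left, W)),
      t ∈ W ∧ W ≤ N ∧ (∀ a ∈ I, ∀ b ∈ I, a * b = 0) ∧
      (Spec.map (CommRingCat.ofHom (Ideal.Quotient.mk I)) ≫ hW.fromSpec) ≫ x.left =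
        (Spec.map (CommRingCat.ofHom (Ideal.Quotient.mk I)) ≫ hW.fromSpec) ≫ y.left := by
  obtain ⟨k, hk⟩ := hxy
  obtain ⟨W, hW, I, htW, hWN, hI, z, hz⟩ :=
    exists_squareZero_factor (pullback.diagonal X.hom).liftCoborder k t N ht
  refine ⟨W, hW, I, htW, hWN, hI, ?_⟩
  have h : (Spec.map (CommRingCat.ofHom (Ideal.Quotient.mk I)) ≫ hW.fromSpec) ≫
      pullback.lift x.left y.left ((Over.w x).trans (Over.w y).symm) =
      z ≫ pullback.diagonal X.hom := by
    have := congrArg (· ≫ (pullback.diagonal X.hom).coborderRange.ι) hz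
    simp only [Category.assoc, Scheme.Hom.liftCoborder_ι] at this
    rw [← this, ← hk, Category.assoc]
    rfl
  have hx := congrArg (· ≫ pullback.fst _ _) h
  have hy := congrArg (· ≫ pullback.snd _ _) h
  simp only [Category.assoc, pullback.lift_fst, pullback.lift_snd, pullback.diagonal_fst,
    pullback.diagonal_snd] at hx hy ⊢
  exact hx.trans hy.symm

/-- The `T`-valued points of `G` which are trivial on the locus where the `T`-valued points `x` and
`y` of `X` coincide. -/
def coincidenceKernel (G : Over S) [GrpObj G] {X T : Over S} (x y : T ⟶ X) :
    Subgroup (T ⟶ G) where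
  carrier := {g | ∀ ⦃T' : Over S⦄ (f : T' ⟶ T), f ≫ x = f ≫ y → f ≫ g = 1}
  mul_mem' hg hh _ f hf := by rw [MonObj.comp_mul, hg f hf, hh f hf, one_mul]
  one_mem' _ f _ := MonObj.comp_one f
  inv_mem' hg _ f hf := by rw [GrpObj.comp_inv, hg f hf, inv_one]

instance (G : Over S) [GrpObj G] {X T : Over S} (x y : T ⟶ X) :
    (coincidenceKernel G x y).Normal where
  conj_mem g hg h _ f hf := by
    rw [MonObj.comp_mul, MonObj.comp_mul, hg f hf, mul_one, ← MonObj.comp_mul, mul_inv_cancel,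
      MonObj.comp_one]

/-- For close points `x` and `y` the locus `x = y` is defined, locally on `T`, by an ideal of square
zero, hence the points of `G` which are trivial on it commute. -/
lemma Close.mul_comm_of_mem {G : Over S} [GrpObj G] {X T : Over S} {x y : T ⟶ X}
    (hxy : Close x y) {g h : T ⟶ G} (hg : g ∈ coincidenceKernel G x y)
    (hh : h ∈ coincidenceKernel G x y) : g * h = h * g := by
  refine Over.OverMorphism.ext (Scheme.hom_ext_of_forall _ _ fun t => ?_)
  obtain ⟨U, hU, htU, -⟩ := exists_isAffineOpen_mem_and_subset
    (X := G.left) (x := (1 : T ⟶ G).left t) (U := ⊤) trivial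
  obtain ⟨V, hV, htV, -⟩ := exists_isAffineOpen_mem_and_subset
    (X := S) (x := T.hom t) (U := ⊤) trivial
  obtain ⟨W, hW, I, htW, hWN, hI, hxyI⟩ := hxy.exists_squareZero t
    ((1 : T ⟶ G).left ⁻¹ᵁ U ⊓ T.hom ⁻¹ᵁ V) ⟨htU, htV⟩
  refine ⟨W, htW, ?_⟩
  let p : Over.mk (hW.fromSpec ≫ T.hom) ⟶ T := Over.homMk hW.fromSpec
  let q : Over.mk (Spec.map (CommRingCat.ofHom (Ideal.Quotient.mk I)) ≫ hW.fromSpec ≫ T.hom) ⟶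
      Over.mk (hW.fromSpec ≫ T.hom) := Over.homMk (Spec.map _)
  have hq : (q ≫ p) ≫ x = (q ≫ p) ≫ y := Over.OverMorphism.ext hxyI
  have triv {k : T ⟶ G} (hk : k ∈ coincidenceKernel G x y) : q ≫ 1 = q ≫ p ≫ k :=
    (MonObj.comp_one q).trans ((Category.assoc _ _ _).symm.trans (hk _ hq)).symm
  have hmem (z) : hW.fromSpec z ∈ W := hW.range_fromSpec.subset ⟨z, rfl⟩
  have key : (p ≫ g) * (p ≫ h) = (p ≫ h) * (p ≫ g) := by
    refine SquareZero.mul_comm_of_trivial_mod hI G _ _ _ (congrArg (·.left) (triv hg))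
      (congrArg (·.left) (triv hh)) hU hV ?_ ?_
    · rintro _ ⟨z, rfl⟩
      rw [← MonObj.comp_one p]
      exact (hWN (hmem z)).1
    · rintro _ ⟨z, rfl⟩
      exact (hWN (hmem z)).2
  rw [← MonObj.comp_mul, ← MonObj.comp_mul] at key
  have key' : hW.fromSpec ≫ (g * h).left = hW.fromSpec ≫ (h * g).left := congrArg (·.left) key
  rw [← hW.isoSpec_hom_fromSpec, Category.assoc, key', Category.assoc]

end GerbeForms

/-! ### The product rule for the twisted de Rham differential -/

/-- The group theory behind the product rule for the combinatorial de Rham differential. In the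
subgroup generated by two commutative normal subgroups `K` and `L` the elements of `K ⊓ L` are
central, so that it is enough to compare the commutators `⁅b₁, a₂⁆` and `⁅a₁, b₂⁆`; they are equal
because `a₃` and `b₃`, which are `a₁ * a₂` and `b₁ * b₂` up to central elements, commute. -/
lemma mul_mul_inv_eq_of_commute {H : Type*} [Group H] (K L : Subgroup H) [K.Normal] [L.Normal]
    (hK : ∀ x ∈ K, ∀ y ∈ K, x * y = y * x) (hL : ∀ x ∈ L, ∀ y ∈ L, x * y = y * x)
    {a₁ a₂ a₃ b₁ b₂ b₃ : H} (ha₁ : a₁ ∈ K) (hb₁ : b₁ ∈ K) (ha₂ : a₂ ∈ L) (hb₂ : b₂ ∈ L)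
    (h₃ : a₃ * b₃ = b₃ * a₃) (hA : a₁ * a₂ * a₃⁻¹ ∈ K ⊓ L) (hB : b₁ * b₂ * b₃⁻¹ ∈ K ⊓ L) :
    (a₁ * b₁) * (a₂ * b₂) * (a₃ * b₃)⁻¹ =
      (a₁ * a₂ * a₃⁻¹) * (b₁ * (a₁ * b₂ * a₁⁻¹) * b₃⁻¹) := by
  have comm_mem {x y : H} (hx : x ∈ K) (hy : y ∈ L) : x * y * x⁻¹ * y⁻¹ ∈ K ⊓ L := by
    refine ⟨?_, L.mul_mem (Subgroup.Normal.conj_mem inferInstance y hy x) (L.inv_mem hy)⟩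
    rw [mul_assoc x, mul_assoc x]
    exact K.mul_mem hx (Subgroup.Normal.conj_mem inferInstance _ (K.inv_mem hx) y)
  obtain ⟨A, hA'⟩ : ∃ A, A = a₁ * a₂ * a₃⁻¹ := ⟨_, rfl⟩
  obtain ⟨B, hB'⟩ : ∃ B, B = b₁ * b₂ * b₃⁻¹ := ⟨_, rfl⟩
  obtain ⟨C, hC'⟩ : ∃ C, C = b₁ * a₂ * b₁⁻¹ * a₂⁻¹ := ⟨_, rfl⟩
  obtain ⟨D, hD'⟩ : ∃ D, D = a₁ * b₂ * a₁⁻¹ * b₂⁻¹ := ⟨_, rfl⟩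
  have hC := hC' ▸ comm_mem hb₁ ha₂
  have hD := hD' ▸ comm_mem ha₁ hb₂
  rw [← hA'] at hA ⊢
  rw [← hB'] at hB
  have ea : a₃ = A⁻¹ * (a₁ * a₂) := by rw [hA']; group
  have eb : b₃ = B⁻¹ * (b₁ * b₂) := by rw [hB']; group
  have e1 : a₁ * a₂ * (b₁ * b₂) = b₁ * b₂ * (a₁ * a₂) := by
    have cA : Commute A⁻¹ (b₁ * b₂) := Commute.inv_left
      (Commute.mul_right (hK _ hA.1 _ hb₁) (hL _ hA.2 _ hb₂))
    have cB : Commute B⁻¹ (a₁ * a₂) := Commute.inv_left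
      (Commute.mul_right (hK _ hB.1 _ ha₁) (hL _ hB.2 _ ha₂))
    have cAB : Commute A⁻¹ B⁻¹ := Commute.inv_inv (hK _ hA.1 _ hB.1)
    rw [ea, eb, cB.symm.mul_mul_mul_comm, cA.symm.mul_mul_mul_comm, cAB.eq] at h₃
    exact mul_left_cancel h₃
  have hCD : C = D := by
    have e2 : a₁ * a₂ * (b₁ * b₂) = C⁻¹ * (a₁ * b₁ * (a₂ * b₂)) := by
      have : Commute a₁ C⁻¹ := Commute.inv_right (hK _ ha₁ _ hC.1)
      calc _ = a₁ * C⁻¹ * (b₁ * a₂ * b₂) := by rw [hC']; group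
        _ = _ := by rw [this.eq]; group
    have e3 : b₁ * b₂ * (a₁ * a₂) = D⁻¹ * (a₁ * b₁ * (a₂ * b₂)) := by
      have : Commute b₁ D⁻¹ := Commute.inv_right (hK _ hb₁ _ hD.1)
      calc _ = b₁ * D⁻¹ * (a₁ * (b₂ * a₂)) := by rw [hD']; group
        _ = D⁻¹ * (b₁ * a₁ * (b₂ * a₂)) := by rw [this.eq]; group
        _ = _ := by rw [hK _ hb₁ _ ha₁, hL _ hb₂ _ ha₂]
    rw [e2, e3] at e1
    exact inv_injective (mul_right_cancel e1)
  have cB : Commute B (a₁ * a₂)⁻¹ := Commute.inv_right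
    (Commute.mul_right (hK _ hB.1 _ ha₁) (hL _ hB.2 _ ha₂))
  calc _ = a₁ * b₁ * a₂ * b₁⁻¹ * (B * (a₁ * a₂)⁻¹) * A := by rw [ea, eb]; group
    _ = (a₁ * C) * a₁⁻¹ * (B * A) := by rw [cB.eq, hC']; group
    _ = C * (B * A) := by rw [hK _ ha₁ _ hC.1]; group
    _ = A * (B * D) := by
      rw [hK _ hB.1 _ hA.1, hK _ hC.1 _ (K.mul_mem hA.1 hB.1), hCD, mul_assoc]
    _ = A * ((b₁ * D) * (b₁⁻¹ * B)) := by
      rw [hK _ hb₁ _ hD.1, hK _ hB.1 _ hD.1]; group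
    _ = _ := by rw [hB', hD']; group

namespace GerbeForms

variable {S : Scheme.{u}} {G : Over S} [GrpObj G] {X : Over S} {n : ℕ} {W W' : X.left.Opens}

namespace GForm

lemma val_mem_coincidenceKernel (ω : GForm G n W) {T : Over S} (s : Simplex X n T) (h : s.In W)
    (a : Fin n) : ω.val s h ∈ coincidenceKernel G (s.pt a.castSucc) (s.pt a.succ) :=
  fun _ f hf => (ω.val_pull f s h).symm.trans (ω.val_degenerate _ _ a hf)

/-- The values of a 1-form lie in the commutative group of points which are trivial where the two
vertices coincide, hence 1-forms commute. -/
lemma mul_comm_one_form (ω ω' : GForm G 1 W) : ω * ω' = ω' * ω :=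
  GForm.ext (by
    funext T s h
    exact (s.close 0 1).mul_comm_of_mem (ω.val_mem_coincidenceKernel s h 0)
      (ω'.val_mem_coincidenceKernel s h 0))

end GForm

namespace AutForm

lemma val_mem_coincidenceKernel (u : AutForm G n W) {T : Over S} (s : Simplex X n T)
    (h : s.In W) {x y : T ⟶ X} {g : T ⟶ G} (hg : g ∈ coincidenceKernel G x y) :
    u.val s h g ∈ coincidenceKernel G x y :=
  fun _ f hf => by rw [← u.val_pull f s h g, hg f hf, map_one]

lemma act_inv (u : AutForm G 0 W) (ω : GForm G n W) : u.act ω⁻¹ = (u.act ω)⁻¹ :=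
  GForm.ext (by
    funext T s h
    exact map_inv (u.val (s.face ![0]) (h.face _)) (ω.val s h))

/-- The gauge transform `Ad(a) ∘ m` of an `Aut(G)`-valued 1-form `m` by a `G`-valued 1-form `a`. -/
def twist (m : AutForm G 1 W) (a : GForm G 1 W) : AutForm G 1 W where
  val s h := (m.val s h).trans (MulAut.conj (a.val s h))
  val_pull f s h g := by
    simp only [MulEquiv.trans_apply, MulAut.conj_apply]
    rw [m.val_pull, a.val_pull, MonObj.comp_mul, MonObj.comp_mul, GrpObj.comp_inv]
  val_degenerate s h i hi := by
    rw [m.val_degenerate s h i hi, a.val_degenerate s h i hi]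
    ext g
    simp

lemma twist_val (m : AutForm G 1 W) (a : GForm G 1 W) {T : Over S} (s : Simplex X 1 T)
    (h : s.In W) (g : T ⟶ G) :
    (m.twist a).val s h g = a.val s h * m.val s h g * (a.val s h)⁻¹ := rfl

lemma twist_twist (m : AutForm G 1 W) (a b : GForm G 1 W) :
    (m.twist a).twist b = m.twist (b * a) :=
  AutForm.ext (by
    funext T s h
    ext1 g
    change b.val s h * (a.val s h * m.val s h g * (a.val s h)⁻¹) * (b.val s h)⁻¹ =
      b.val s h * a.val s h * m.val s h g * (b.val s h * a.val s h)⁻¹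
    group)

lemma twist_one (m : AutForm G 1 W) : m.twist 1 = m :=
  AutForm.ext (by
    funext T s h
    ext1 g
    change 1 * m.val s h g * 1⁻¹ = m.val s h g
    group)

/-- The product rule `d¹ₘ(a + b) = d¹ₘ(a) + d¹ₘ'(b)` with `m' = Ad(a) ∘ m`. -/
lemma d1_mul (m : AutForm G 1 W) (a b : GForm G 1 W) :
    m.d1 (a * b) = m.d1 a * (m.twist a).d1 b := by
  refine GForm.ext ?_
  funext T s h
  have mem₁ (ω : GForm G 1 W) : ω.val (s.face ![0, 1]) (h.face _) ∈
      coincidenceKernel G (s.pt 0) (s.pt 1) :=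
    ω.val_mem_coincidenceKernel (s.face ![0, 1]) (h.face _) 0
  have mem₂ (ω : GForm G 1 W) :
      m.val (s.face ![0, 1]) (h.face _) (ω.val (s.face ![1, 2]) (h.face _)) ∈
        coincidenceKernel G (s.pt 1) (s.pt 2) :=
    m.val_mem_coincidenceKernel _ _
      (ω.val_mem_coincidenceKernel (s.face ![1, 2]) (h.face _) 0)
  have mem (ω : GForm G 1 W) : (m.d1 ω).val s h ∈
      coincidenceKernel G (s.pt 0) (s.pt 1) ⊓ coincidenceKernel G (s.pt 1) (s.pt 2) :=
    ⟨(m.d1 ω).val_mem_coincidenceKernel s h 0, (m.d1 ω).val_mem_coincidenceKernel s h 1⟩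
  have comm : a.val (s.face ![0, 2]) (h.face _) * b.val (s.face ![0, 2]) (h.face _) =
      b.val (s.face ![0, 2]) (h.face _) * a.val (s.face ![0, 2]) (h.face _) :=
    congrArg (fun ω : GForm G 1 W => ω.val (s.face ![0, 2]) (h.face _))
      (GForm.mul_comm_one_form a b)
  have key := mul_mul_inv_eq_of_commute (coincidenceKernel G (s.pt 0) (s.pt 1))
    (coincidenceKernel G (s.pt 1) (s.pt 2))
    (fun _ hx _ hy => (s.close 0 1).mul_comm_of_mem hx hy)
    (fun _ hx _ hy => (s.close 1 2).mul_comm_of_mem hx hy)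
    (mem₁ a) (mem₁ b) (mem₂ a) (mem₂ b) comm (mem a) (mem b)
  rw [← map_mul] at key
  exact key

lemma val_congr (u : AutForm G 0 W) {T : Over S} {s t : Simplex X 0 T} (hs : s.In W) (ht : t.In W)
    (e : s.pt 0 = t.pt 0) : u.val s hs = u.val t ht := by
  obtain rfl : s = t := Simplex.ext (funext fun i => by
    obtain rfl : i = 0 := Fin.fin_one_eq_zero i
    exact e)
  rfl

/-! ### Sections of `Aut(G)` intertwining two `Aut(G)`-valued 1-forms -/

/-- The section `u` of `Aut(G)` carries `m` to `m'`, that is `u(x) ∘ m(x, y) = m'(x, y) ∘ u(y)`. -/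
def Intertwines (u : AutForm G 0 W) (m m' : AutForm G 1 W) : Prop :=
  ∀ ⦃T : Over S⦄ (s : Simplex X 1 T) (h : s.In W) (g : T ⟶ G),
    u.val (s.face ![0]) (h.face _) (m.val s h g) = m'.val s h (u.val (s.face ![1]) (h.face _) g)

namespace Intertwines

variable {u v : AutForm G 0 W} {m m' m'' : AutForm G 1 W}

lemma restrict (hu : u.Intertwines m m') (hW : W' ≤ W) :
    (u.restrict hW).Intertwines (m.restrict hW) (m'.restrict hW) :=
  fun _ s h g => hu s (h.mono hW) g

lemma mul (hu : u.Intertwines m' m'') (hv : v.Intertwines m m') :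
    (u * v).Intertwines m m'' := fun _ s h g =>
  (congrArg (u.val (s.face ![0]) (h.face _)) (hv s h g)).trans (hu s h _)

lemma inv (hu : u.Intertwines m m') : u⁻¹.Intertwines m' m := fun _ s h g => by
  change (u.val (s.face ![0]) (h.face _)).symm _ =
    m.val s h ((u.val (s.face ![1]) (h.face _)).symm g)
  rw [MulEquiv.symm_apply_eq, hu s h, MulEquiv.apply_symm_apply]

lemma twist (hu : u.Intertwines m m') (a : GForm G 1 W) :
    u.Intertwines (m.twist a) (m'.twist (u.act a)) := fun _ s h g => by
  rw [twist_val, twist_val, map_mul, map_mul, map_inv, hu s h]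
  rfl

/-- The twisted de Rham differential is compatible with the action of sections of `Aut(G)`. -/
lemma act_d1 (hu : u.Intertwines m m') (ω : GForm G 1 W) :
    u.act (m.d1 ω) = m'.d1 (u.act ω) := by
  refine GForm.ext ?_
  funext T s h
  -- Iterated faces with the same vertex need not be definitionally equal.
  have e₀₁ := u.val_congr (s := s.face ![0]) (t := (s.face ![0, 1]).face ![0]) (h.face _)
    ((h.face _).face _) rfl
  have e₀₂ := u.val_congr (s := s.face ![0]) (t := (s.face ![0, 2]).face ![0]) (h.face _)
    ((h.face _).face _) rfl
  have e₁₂ := u.val_congr (s := (s.face ![0, 1]).face ![1]) (t := (s.face ![1, 2]).face ![0])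
    ((h.face _).face _) ((h.face _).face _) rfl
  have e := hu (s.face ![0, 1]) (h.face _) (ω.val (s.face ![1, 2]) (h.face _))
  rw [← e₀₁, e₁₂] at e
  change u.val (s.face ![0]) (h.face _) (_ * _ * _⁻¹) =
    u.val ((s.face ![0, 1]).face ![0]) ((h.face _).face _) _ * _ *
      (u.val ((s.face ![0, 2]).face ![0]) ((h.face _).face _) _)⁻¹
  rw [map_mul, map_mul, map_inv, e, ← e₀₁, ← e₀₂]
  rfl

end Intertwines

end AutForm

end GerbeForms

/-! ### The twisted Čech differential and local data of a gerbe with connection -/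

/-- For `t' ∘ F(φ₁) = c ∘ φ₀ ∘ t`, the transport `m'` of the conjugate `φ₁ g φ₁⁻¹` along `t'` and
the transport `m` of `g` along `t` are related by `m' ∘ c = c ∘ φ₀ m φ₀⁻¹`. -/
lemma conj_comp_eq_of_transport {𝒞 𝒟 : Type*} [Category* 𝒞] [Category* 𝒟] (F : 𝒞 ⥤ 𝒟)
    {y y' : 𝒞} {x x' : 𝒟} (φ₁ : y ≅ y') (φ₀ : x ≅ x') (t : F.obj y ≅ x) (t' : F.obj y' ≅ x')
    (c m' : x' ⟶ x') (g : y ⟶ y) (m : x ⟶ x) (hc : t.hom ≫ φ₀.hom ≫ c = F.map φ₁.hom ≫ t'.hom)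
    (hm : t.hom ≫ m = F.map g ≫ t.hom)
    (hm' : t'.hom ≫ m' = F.map (φ₁.inv ≫ g ≫ φ₁.hom) ≫ t'.hom) :
    c ≫ m' = (φ₀.inv ≫ m ≫ φ₀.hom) ≫ c := by
  rw [← cancel_epi φ₀.hom, ← cancel_epi t.hom]
  simp only [Category.assoc, Iso.hom_inv_id_assoc]
  rw [reassoc_of% hc, hm', reassoc_of% hm, hc, ← Functor.map_comp_assoc, ← Functor.map_comp_assoc,
    Iso.hom_inv_id_assoc]

namespace GerbeForms

variable {S : Scheme.{u}} {G : Over S} [GrpObj G] {X : Over S}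

namespace LocalData

variable {P : Fibred.{w, v, u} X} {C : Connection P} {I : Type*} {U : I → X.left.Opens}
  (D : LocalData G C U)

/-- The sections `λᵢⱼ`, the forms `mᵢ` and the forms `γᵢⱼ` are related by
`mᵢ(x, y)(λᵢⱼ(y)(g)) γᵢⱼ(x, y) = γᵢⱼ(x, y) λᵢⱼ(x)(mⱼ(x, y)(g))`: both sides arise by transport of
`g` along `γᵢ ∘ ε(φᵢⱼ) = γᵢⱼ ∘ φᵢⱼ ∘ γⱼ`. -/
lemma m_lam_mul_gamma (i j : I) {T : Over S} (s : Simplex X 1 T) (h : s.In (U i ⊓ U j))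
    (g : T ⟶ G) :
    (D.m i).val s (h.mono inf_le_left) ((D.lam i j).val (s.face ![1]) (h.face _) g) *
        (D.gamma i j).val s h =
      (D.gamma i j).val s h *
        (D.lam i j).val (s.face ![0]) (h.face _) ((D.m j).val s (h.mono inf_le_right) g) := by
  have hi : s.In (U i) := h.mono inf_le_left
  have hj : s.In (U j) := h.mono inf_le_right
  let e : InfPair X := ⟨T, s⟩
  let B := D.bandOn i ((InfPair.vertex 0).obj e) (hi 0)
  have a1 := D.gam_gammaOn i j e h
  have a2 := D.gam_mOn i e hi (D.lamOn i j ((InfPair.vertex 1).obj e) (h 1) g)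
  have a3 := D.gam_mOn j e hj g
  have a4 := congrArg Iso.hom (D.bandOn_lamOn i j ((InfPair.vertex 1).obj e) (h 1) g)
  have a5 := congrArg Iso.hom (D.bandOn_lamOn i j ((InfPair.vertex 0).obj e) (h 0)
    (D.mOn j e hj g))
  have key := conj_comp_eq_of_transport (C.ε.fiber e) _ _ _ _ _ _ _ _ a1 a3
    (a2.trans (congrArg (fun a => (C.ε.fiber e).map a ≫ (D.gam i e hi).hom) a4))
  apply B.injective
  refine (map_mul B _ _).trans (Eq.trans (Iso.ext ?_) (map_mul B _ _).symm)
  exact key.trans (congrArg (· ≫ _) a5.symm)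

/-- The section `λᵢⱼ` carries `mⱼ` to the gauge transform of `mᵢ` by `-γᵢⱼ`. -/
lemma lam_intertwines (i j : I) :
    (D.lam i j).Intertwines ((D.m j).restrict inf_le_right)
      (((D.m i).restrict inf_le_left).twist (D.gamma i j)⁻¹) := fun T s h g => by
  rw [AutForm.twist_val]
  change _ = ((D.gamma i j).val s h)⁻¹ * _ * ((D.gamma i j).val s h)⁻¹⁻¹
  rw [inv_inv, mul_assoc, eq_inv_mul_iff_mul_eq]
  exact (D.m_lam_mul_gamma i j s h g).symm

end LocalData

/-- If `λᵢⱼ` carries `mⱼ` to `Ad(ωᵢⱼ) ∘ mᵢ`, then `λᵢⱼₖ` carries `mᵢ` to its gauge transform by the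
Čech differential of `ω`. -/
lemma lam3_intertwines {I : Type*} {U : I → X.left.Opens} (l : ∀ i j, AutForm G 0 (U i ⊓ U j))
    (m : ∀ i, AutForm G 1 (U i)) (ω : ∀ i j, GForm G 1 (U i ⊓ U j))
    (H : ∀ i j, (l i j).Intertwines ((m j).restrict inf_le_right)
      (((m i).restrict inf_le_left).twist (ω i j))) (i j k : I) :
    (lam3 l i j k).Intertwines ((m i).restrict (inf_le_left.trans inf_le_left))
      (((m i).restrict (inf_le_left.trans inf_le_left)).twist (cech1 l ω i j k)) := by
  have hij : U i ⊓ U j ⊓ U k ≤ U i ⊓ U j := inf_le_left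
  have hjk : U i ⊓ U j ⊓ U k ≤ U j ⊓ U k := le_inf (inf_le_left.trans inf_le_right) inf_le_right
  have hik : U i ⊓ U j ⊓ U k ≤ U i ⊓ U k := le_inf (inf_le_left.trans inf_le_left) inf_le_right
  let M : AutForm G 1 (U i ⊓ U j ⊓ U k) := (m i).restrict (inf_le_left.trans inf_le_left)
  let a := (ω i j).restrict hij
  let b := ((l i j).restrict hij).act ((ω j k).restrict hjk)
  let c := (ω i k).restrict hik
  have key : (lam3 l i j k).Intertwines ((M.twist c).twist c⁻¹)
      (((M.twist a).twist b).twist ((lam3 l i j k).act c⁻¹)) :=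
    ((((H i j).restrict hij).twist ((ω j k).restrict hjk)).mul ((H j k).restrict hjk)).mul
      ((H i k).restrict hik).inv |>.twist c⁻¹
  rw [AutForm.twist_twist, AutForm.twist_twist, AutForm.twist_twist, inv_mul_cancel,
    AutForm.twist_one, AutForm.act_inv, mul_assoc,
    GForm.mul_comm_one_form b a, GForm.mul_comm_one_form _ (a * b)] at key
  exact key

/-- The twisted Čech differential commutes with the twisted de Rham differential on 1-forms, as soon
as `λᵢⱼ` carries `mⱼ` to `Ad(ωᵢⱼ) ∘ mᵢ`. -/
theorem d1_cech1 {I : Type*} {U : I → X.left.Opens} (l : ∀ i j, AutForm G 0 (U i ⊓ U j))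
    (m : ∀ i, AutForm G 1 (U i)) (ω : ∀ i j, GForm G 1 (U i ⊓ U j))
    (H : ∀ i j, (l i j).Intertwines ((m j).restrict inf_le_right)
      (((m i).restrict inf_le_left).twist (ω i j))) (i j k : I) :
    ((m i).restrict (inf_le_left.trans inf_le_left)).d1 (cech1 l ω i j k) =
      cech1 l (deRham1 m ω) i j k := by
  have hjk := ((H i j).restrict (inf_le_left : U i ⊓ U j ⊓ U k ≤ _)).act_d1
    ((ω j k).restrict (le_inf (inf_le_left.trans inf_le_right) inf_le_right))
  have hik := (lam3_intertwines l m ω H i j k).act_d1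
    ((ω i k).restrict (le_inf (inf_le_left.trans inf_le_left) inf_le_right))
  have h1 := AutForm.d1_mul ((m i).restrict (inf_le_left.trans inf_le_left))
    ((ω i j).restrict (inf_le_left : U i ⊓ U j ⊓ U k ≤ _))
    (((l i j).restrict inf_le_left).act
      ((ω j k).restrict (le_inf (inf_le_left.trans inf_le_right) inf_le_right)))
  -- The cochain `cech1 l ω i j k` is `a + b - e` with `a = ωᵢⱼ`, `b = λᵢⱼ(ωⱼₖ)` and
  -- `e = λᵢⱼₖ(ωᵢₖ)`. The differential of `a + b` is expanded in two ways, as that of `a + b` and as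
  -- that of `(a + b - e) + e`.
  have h2 := AutForm.d1_mul ((m i).restrict (inf_le_left.trans inf_le_left)) (cech1 l ω i j k)
    ((lam3 l i j k).act
      ((ω i k).restrict (le_inf (inf_le_left.trans inf_le_left) inf_le_right)))
  rw [← hik] at h2
  rw [cech1, inv_mul_cancel_right, h1] at h2
  refine eq_mul_inv_of_mul_eq (h2.symm.trans ?_)
  exact congrArg (_ * ·) hjk.symm

end GerbeForms

end

theorem mainTheorem6 {S : Scheme.{u}} (h2 : IsUnit (2 : Γ(S, ⊤))) (h3 : IsUnit (3 : Γ(S, ⊤)))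
    (G : Over S) [GrpObj G] [Flat G.hom] (X : Over S)
    (J : GrothendieckTopology (Over X)) (P : GerbeForms.Fibred.{w, v, u} X)
    (hP : GerbeForms.IsGerbe J P) (C : GerbeForms.Connection P)
    {I : Type*} (U : I → X.left.Opens) (hU : ⨆ i, U i = ⊤)
    (D : GerbeForms.LocalData G C U) (i j k : I) :
    ((D.m i).restrict (inf_le_left.trans inf_le_left)).d1
        (GerbeForms.cech1 D.lam (fun i j => (D.gamma i j)⁻¹) i j k) =
      GerbeForms.cech1 D.lam
        (GerbeForms.deRham1 D.m (fun i j => (D.gamma i j)⁻¹)) i j k := by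
  exact GerbeForms.d1_cech1 D.lam D.m _ D.lam_intertwines i j k
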